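/- Let $\mathcal X$ be a finite alphabet, $M>2$, and let $P_1,\dots,P_M$ be probability distributions on $\mathcal X$. All logarithms are natural. For distributions $P,Q$ on $\mathcal X$ and $\alpha\ge 0$ put $$\mathrm{GJS}(P,Q,\alpha)=\alpha D\Big(P\,\Big\|\,\tfrac{\alpha P+Q}{1+\alpha}\Big)+D\Big(Q\,\Big\|\,\tfrac{\alpha P+Q}{1+\alpha}\Big),\qquad C(P,Q)=-\inf_{\eta\in[0,1]}\log\sum_{x}P(x)^{\eta}Q(x)^{1-\eta}\in[0,\infty],$$ where $D$ is relative entropy. Under hypothesis $H_i$ ($i\in[M]$) one has training sequences $X_1^N,\dots,X_M^N$ of length $N$ and a test sequence $Y_1,Y_2,\dots$, all samples being independent, those of $X_j^N$ with law $P_j$ and those of $Y$ with law $P_i$; the corresponding probability and expectation are $\mathrm P_i$ and $\mathbb E_i$. Write $\hat P_{x^n}$ for the empirical distribution of a sequence $x^n$. For a threshold $\gamma\ge0$ let $$\Psi_n=\Big\{i\in[M]:\ \exists\,1\le k\le n,\ k\,\mathrm{GJS}\big(\hat P_{X_i^N},\hat P_{Y^k},\tfrac Nk\big)\ge\gamma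 N\Big\},\qquad T=\inf\{n\ge1:|\Psi_n|\ge M-1\}\wedge N^2,\qquad d=[M]\setminus\Psi_T .$$ The test stops at time $T$ and declares $H_i$ if $d=\{i\}$; its error probability under $H_i$ is $P_{\mathrm{err},i}=\mathrm P_i(d\neq\{i\})$, and its error exponent is $$e_i=\liminf_{N\to\infty}\frac{-\log P_{\mathrm{err},i}}{\mathbb E_i[T]}\qquad(-\log 0=\infty).$$ Suppose that $0\le\gamma\le\min_{i\ne j}C(P_i,P_j)$, and that $P_i$ and $P_j$ have the same support whenever $i\neq j$ and $\gamma=C(P_i,P_j)$ (this holds in particular if all $P_i$ have full support). If $\gamma>0$, then for all $i\ne j$ the equation $$\mathrm{GJS}\big(P_j,P_i,\theta\big)=\gamma\,\theta$$ has exactly one solution $\theta=\theta^\star_{i(j),\gamma}>0$, and $P_{\mathrm{err},i}\to0$ as $N\to\infty$ for every $i$. Moreover, for every $\gamma$ as above (where, for $\gamma=0$, $\theta^\star_{i(j),\gamma}$ is any solution $\theta\ge0$) and every $i\in[M]$, $$e_i\ \ge\ \min_{j\ne i}\mathrm{GJS}\big(P_j,P_i,\theta^\star_{i(j),\gamma}\big).$$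 -/

import Mathlib

open Filter Topology MeasureTheory

namespace SeqClass

noncomputable section

/-- Relative entropy `∑ P(a) log (P(a) / Q(a))` (natural logarithm) of two mass functions on a finite
alphabet. It is only used below with `P` absolutely continuous with respect to `Q`, or multiplied
by `0`, so the convention `x / 0 = 0` plays no role. -/
def kl {X : Type*} [Fintype X] (P Q : X → ℝ) : ℝ :=
  ∑ a, P a * Real.log (P a / Q a)

/-- The mixture `(α P + Q) / (1 + α)`. -/
def mix {X : Type*} (P Q : X → ℝ) (α : ℝ) : X → ℝ :=
  fun a => (α * P a + Q a) / (1 + α)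

/-- Generalized Jensen-Shannon divergence `GJS(P, Q, α)`. -/
def gjs {X : Type*} [Fintype X] (P Q : X → ℝ) (α : ℝ) : ℝ :=
  α * kl P (mix P Q α) + kl Q (mix P Q α)

/-- The mass function of a distribution, with real values. -/
def mass {X : Type*} (P : PMF X) : X → ℝ := fun a => (P a).toReal

/-- Chernoff information `- min_{η ∈ [0,1]} log ∑ P(x)^η Q(x)^(1-η)`; it is `⊤` exactly when the
supports are disjoint. -/
def chernoff {X : Type*} [Fintype X] (P Q : PMF X) : EReal :=
  -⨅ η : Set.Icc (0 : ℝ) 1, ENNReal.log (∑ x, P x ^ (η : ℝ) * Q x ^ (1 - (η : ℝ)))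

/-- `θ` is the solution in `[0, ∞)` of `GJS(P, Q, θ) = γ θ`, the trivial solution `θ = 0` being
discarded when `γ > 0`. -/
def IsThetaStar {X : Type*} [Fintype X] (P Q : PMF X) (γ θ : ℝ) : Prop :=
  0 ≤ θ ∧ (0 < γ → 0 < θ) ∧ gjs (mass P) (mass Q) θ = γ * θ

/-- Type (empirical distribution) of a sequence of length `n`. -/
def empDist {X : Type*} [DecidableEq X] {n : ℕ} (x : Fin n → X) : X → ℝ :=
  fun a => (1 / (n : ℝ)) * ∑ k, if x k = a then 1 else 0

/-- Observations: `M` training sequences of length `N`, and the infinite sequence of test samples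
(`y 0` is the first test sample). -/
abbrev Obs (X : Type*) (M N : ℕ) : Type _ := (Fin M → Fin N → X) × (ℕ → X)

/-- The law under hypothesis `i`: all samples are independent, the `j`-th training sequence has
i.i.d. entries of law `P j`, and the test samples are i.i.d. of law `P i`. -/
def law {X : Type*} [MeasurableSpace X] {M : ℕ} (P : Fin M → PMF X) (N : ℕ) (i : Fin M) :
    Measure (Obs X M N) :=
  (Measure.pi fun j => Measure.pi fun _ : Fin N => (P j).toMeasure).prod
    (Measure.infinitePi fun _ : ℕ => (P i).toMeasure)

/-- The score `k GJS(X_i^N, Y^k, N / k)` of class `i` at time `k`. -/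
def score {X : Type*} [Fintype X] [DecidableEq X] {M N : ℕ} (ω : Obs X M N) (i : Fin M) (k : ℕ) :
    ℝ :=
  k * gjs (empDist (ω.1 i)) (empDist fun m : Fin k => ω.2 m) ((N : ℝ) / k)

/-- The set `Ψ_n` of classes whose score has reached the threshold `γ N` up to time `n`. -/
def Psi {X : Type*} [Fintype X] [DecidableEq X] {M N : ℕ} (γ : ℝ) (ω : Obs X M N) (n : ℕ) :
    Set (Fin M) :=
  {i | ∃ k, 1 ≤ k ∧ k ≤ n ∧ γ * N ≤ score ω i k}

/-- The stopping time `inf {n ≥ 1 : |Ψ_n| ≥ M - 1} ∧ N ^ 2`. The minimum with `N ^ 2` is taken by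
inserting `N ^ 2` into the set, so that the infimum of the empty set does not occur. -/
def stopTime {X : Type*} [Fintype X] [DecidableEq X] {M N : ℕ} (γ : ℝ) (ω : Obs X M N) : ℕ :=
  sInf (insert (N ^ 2) {n : ℕ | 1 ≤ n ∧ M - 1 ≤ (Psi γ ω n).ncard})

/-- The terminal decision `[M] \ Ψ_T`; it declares class `i` when it equals `{i}`. -/
def decision {X : Type*} [Fintype X] [DecidableEq X] {M N : ℕ} (γ : ℝ) (ω : Obs X M N) :
    Set (Fin M) :=
  (Psi γ ω (stopTime γ ω))ᶜ

/-- The error probability under hypothesis `i` with training sequences of length `N`. -/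
def errProb {X : Type*} [Fintype X] [DecidableEq X] [MeasurableSpace X] {M : ℕ}
    (P : Fin M → PMF X) (γ : ℝ) (i : Fin M) (N : ℕ) : ENNReal :=
  law P N i {ω | decision γ ω ≠ {i}}

/-- The expected number of test samples under hypothesis `i`. -/
def expTime {X : Type*} [Fintype X] [DecidableEq X] [MeasurableSpace X] {M : ℕ}
    (P : Fin M → PMF X) (γ : ℝ) (i : Fin M) (N : ℕ) : ENNReal :=
  ∫⁻ ω, (stopTime γ ω : ENNReal) ∂(law P N i)

/-- The error exponent `liminf_N (- log P_err,i) / E_i[T]`, in `[-∞, ∞]` with `- log 0 = ∞`. -/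
def errExponent {X : Type*} [Fintype X] [DecidableEq X] [MeasurableSpace X] {M : ℕ}
    (P : Fin M → PMF X) (γ : ℝ) (i : Fin M) : EReal :=
  liminf (fun N : ℕ => (-ENNReal.log (errProb P γ i N)) / (expTime P γ i N : EReal)) atTop

end

end SeqClass

open SeqClass

/-! Put `u = k / N`. The score at time `k` is `N φ(p, q, u)`, where `φ(p, q, u)` is the minimum over
`V` of `D(p‖V) + u D(q‖V)`, attained at the mixture (`phi_le`). Hence `φ` increases in `u` from `0`,
strictly when `p ≠ q`, and the threshold equation becomes `φ(P_j, P_i, 1/θ) = γ`. A root exists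
because `γ` is at most the Chernoff information: some order `η` in `(0, 1)` has `∑ P_j^η P_i^(1-η) ≤
e^(-γ)`, which forces `φ` above `γ` for large `u`.

All probabilities are bounded by the method of types (`law_le`). An error requires one of two
events. Either the true class crosses the threshold at some `k ≤ N^2`, which costs `e^(-γN)` because
`V = P_i` competes in the minimum; or a wrong class `j` is still below it at time `N^2`. The second
event is handled by interpolating geometrically between the true pair `(P_j, P_i)` and the common
law `V`: with so many test samples only `V` near `P_i` matters, and there the Chernoff bound again
gives `e^(-γN)` up to `ε` in the exponent (`lik_le_of_score_lt`).

For `c` larger than every `1/θ_j`, `φ(P_j, P_i, c) > γ`, so by compactness a wrong class is still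
below threshold at time `cN` with exponentially small probability. Truncation at `N^2` then gives
`E[T] ≤ cN + 2`. The exponent is thus at least `γ / c`, which tends to `γ min θ_j`, the minimal
divergence. -/

namespace SeqClass

noncomputable section

/-! ### Relative entropy and the normalized divergence -/

section Divergence

variable {X : Type*}

/-- Every symbol charged by `p` is charged by `V`. -/
def Dominates (V p : X → ℝ) : Prop := ∀ a, 0 < p a → 0 < V a

/-- The mixture `(p + u q) / (1 + u)`. -/
def blend (p q : X → ℝ) (u : ℝ) : X → ℝ := fun a => (p a + u * q a) / (1 + u)

lemma mix_eq_blend (p q : X → ℝ) {u : ℝ} (hu : 0 < u) : mix p q u⁻¹ = blend p q u := by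
  funext a
  simp only [mix, blend]
  field_simp
  ring

variable [Fintype X]

/-- The divergence `GJS(p, q, 1 / u)` divided by `1 / u`; unlike `gjs`, it extends to `u = 0`. -/
def phi (p q : X → ℝ) (u : ℝ) : ℝ := kl p (blend p q u) + u * kl q (blend p q u)

lemma gjs_inv (p q : X → ℝ) {u : ℝ} (hu : 0 < u) : gjs p q u⁻¹ = u⁻¹ * phi p q u := by
  simp only [gjs, phi, mix_eq_blend p q hu]
  field_simp

lemma sub_le_mul_log_div {x y : ℝ} (hx : 0 ≤ x) (hy : 0 ≤ y) (h : 0 < x → 0 < y) :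
    x - y ≤ x * Real.log (x / y) := by
  rcases hx.eq_or_lt with rfl | hx
  · simpa using hy
  · have hy := h hx
    have h1 := Real.log_le_sub_one_of_pos (div_pos hy hx)
    rw [← inv_div, Real.log_inv]
    have h2 := mul_le_mul_of_nonneg_left h1 hx.le
    have h3 : x * (y / x - 1) = y - x := by field_simp
    linarith

lemma sub_lt_mul_log_div {x y : ℝ} (hx : 0 ≤ x) (hy : 0 ≤ y) (h : 0 < x → 0 < y) (hne : x ≠ y) :
    x - y < x * Real.log (x / y) := by
  rcases hx.eq_or_lt with rfl | hx
  · simpa using lt_of_le_of_ne hy hne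
  · have hy := h hx
    have h1 := Real.log_lt_sub_one_of_pos (div_pos hy hx) (by
      rw [Ne, div_eq_one_iff_eq hx.ne']; exact hne.symm)
    rw [← inv_div, Real.log_inv]
    have h2 := mul_lt_mul_of_pos_left h1 hx
    have h3 : x * (y / x - 1) = y - x := by field_simp
    linarith

lemma kl_nonneg {p V : X → ℝ} (hp : p ∈ stdSimplex ℝ X) (hV : V ∈ stdSimplex ℝ X)
    (h : Dominates V p) : 0 ≤ kl p V := by
  have := Finset.sum_le_sum fun a (_ : a ∈ Finset.univ) =>
    sub_le_mul_log_div (hp.1 a) (hV.1 a) (h a)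
  rw [Finset.sum_sub_distrib, hp.2, hV.2, sub_self] at this
  exact this

lemma kl_pos {p V : X → ℝ} (hp : p ∈ stdSimplex ℝ X) (hV : V ∈ stdSimplex ℝ X)
    (h : Dominates V p) (hne : p ≠ V) : 0 < kl p V := by
  obtain ⟨b, hb⟩ := Function.ne_iff.1 hne
  have := Finset.sum_lt_sum (fun a (_ : a ∈ Finset.univ) =>
    sub_le_mul_log_div (hp.1 a) (hV.1 a) (h a))
    ⟨b, Finset.mem_univ b, sub_lt_mul_log_div (hp.1 b) (hV.1 b) (h b) hb⟩
  rw [Finset.sum_sub_distrib, hp.2, hV.2, sub_self] at this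
  exact this

lemma blend_mem {p q : X → ℝ} (hp : p ∈ stdSimplex ℝ X) (hq : q ∈ stdSimplex ℝ X) {u : ℝ}
    (hu : 0 ≤ u) : blend p q u ∈ stdSimplex ℝ X := by
  refine ⟨fun a => ?_, ?_⟩
  · have := hp.1 a
    have := hq.1 a
    simp only [blend]
    positivity
  · simp only [blend]
    rw [← Finset.sum_div, Finset.sum_add_distrib, ← Finset.mul_sum, hp.2, hq.2, mul_one,
      div_self (by positivity)]

lemma dominates_blend_left {p q : X → ℝ} (hq : q ∈ stdSimplex ℝ X) {u : ℝ}
    (hu : 0 ≤ u) : Dominates (blend p q u) p := by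
  intro a ha
  have := hq.1 a
  simp only [blend]
  positivity

lemma dominates_blend_right {p q : X → ℝ} (hp : p ∈ stdSimplex ℝ X) {u : ℝ}
    (hu : 0 < u) : Dominates (blend p q u) q := by
  intro a ha
  have := hp.1 a
  simp only [blend]
  positivity

lemma mul_log_div_add {x y z : ℝ} (hx : 0 ≤ x) (hy : 0 < x → 0 < y) (hz : 0 < x → 0 < z) :
    x * Real.log (x / z) = x * Real.log (x / y) + x * (Real.log y - Real.log z) := by
  rcases hx.eq_or_lt with rfl | hx
  · simp
  · rw [Real.log_div hx.ne' (hz hx).ne', Real.log_div hx.ne' (hy hx).ne']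
    ring

lemma kl_eq_add {p V W : X → ℝ} (hp : p ∈ stdSimplex ℝ X) (hV : Dominates V p)
    (hW : Dominates W p) :
    kl p W = kl p V + ∑ a, p a * (Real.log (V a) - Real.log (W a)) := by
  simp only [kl]
  rw [← Finset.sum_add_distrib]
  exact Finset.sum_congr rfl fun a _ => mul_log_div_add (hp.1 a) (hV a) (hW a)

/-- The compensation identity: the mixture minimizes `kl p V + u kl q V`. -/
lemma phi_le {p q V : X → ℝ} (hp : p ∈ stdSimplex ℝ X) (hq : q ∈ stdSimplex ℝ X)
    (hV : V ∈ stdSimplex ℝ X) {u : ℝ} (hu : 0 < u) (hVp : Dominates V p) (hVq : Dominates V q) :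
    phi p q u ≤ kl p V + u * kl q V := by
  have hm := blend_mem hp hq hu.le
  have hmp : Dominates (blend p q u) p := dominates_blend_left hq hu.le
  have hmq : Dominates (blend p q u) q := dominates_blend_right hp hu
  have hVm : Dominates V (blend p q u) := by
    intro a ha
    rcases (hp.1 a).eq_or_lt with h0 | h0
    · rcases (hq.1 a).eq_or_lt with h1 | h1
      · simp only [blend] at ha
        rw [← h0, ← h1] at ha
        simp at ha
      · exact hVq a h1
    · exact hVp a h0
  have h := kl_nonneg hm hV hVm
  have hself : kl (blend p q u) (blend p q u) = 0 := by
    refine Finset.sum_eq_zero fun a _ => ?_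
    rcases eq_or_ne (blend p q u a) 0 with h0 | h0
    · simp [h0]
    · simp [div_self h0]
  rw [kl_eq_add hm (fun a h => h) hVm, hself, zero_add] at h
  rw [kl_eq_add hp hmp hVp, kl_eq_add hq hmq hVq, phi]
  -- The excess of `V` over the mixture is `(1 + u) kl (blend p q u) V`.
  have key : ∑ a, p a * (Real.log (blend p q u a) - Real.log (V a)) +
      u * ∑ a, q a * (Real.log (blend p q u a) - Real.log (V a)) =
      (1 + u) * ∑ a, blend p q u a * (Real.log (blend p q u a) - Real.log (V a)) := by
    rw [Finset.mul_sum, Finset.mul_sum, ← Finset.sum_add_distrib]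
    refine Finset.sum_congr rfl fun a _ => ?_
    have : (1 + u) * blend p q u a = p a + u * q a := by
      simp only [blend]
      field_simp
    rw [← mul_assoc (1 + u), this]
    ring
  have := mul_nonneg (by positivity : (0 : ℝ) ≤ 1 + u) h
  linarith

lemma phi_zero {p q : X → ℝ} : phi p q 0 = 0 := by
  simp only [phi, zero_mul, add_zero, kl, blend, div_one]
  refine Finset.sum_eq_zero fun a _ => ?_
  rcases eq_or_ne (p a) 0 with h0 | h0
  · simp [h0]
  · simp [div_self h0]

/-- The mixture at `v` competes in the minimum at `u`, and raising the weight from `u` to `v` adds a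
nonnegative term. -/
lemma phi_mono {p q : X → ℝ} (hp : p ∈ stdSimplex ℝ X) (hq : q ∈ stdSimplex ℝ X) {u v : ℝ}
    (hu : 0 < u) (huv : u ≤ v) : phi p q u ≤ phi p q v := by
  have hv := hu.trans_le huv
  refine (phi_le hp hq (blend_mem hp hq hv.le) hu (dominates_blend_left hq hv.le)
    (dominates_blend_right hp hv)).trans ?_
  have := kl_nonneg hq (blend_mem hp hq hv.le) (dominates_blend_right hp hv)
  simp only [phi]
  gcongr

lemma phi_strictMono {p q : X → ℝ} (hp : p ∈ stdSimplex ℝ X) (hq : q ∈ stdSimplex ℝ X)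
    (hne : p ≠ q) {u v : ℝ} (hu : 0 < u) (huv : u < v) : phi p q u < phi p q v := by
  have hv := hu.trans huv
  refine (phi_le hp hq (blend_mem hp hq hv.le) hu (dominates_blend_left hq hv.le)
    (dominates_blend_right hp hv)).trans_lt ?_
  have : 0 < kl q (blend p q v) := by
    refine kl_pos hq (blend_mem hp hq hv.le) (dominates_blend_right hp hv) fun h => hne ?_
    funext a
    have h := congrFun h a
    simp only [blend] at h
    rw [eq_div_iff (by positivity)] at h
    linarith
  simp only [phi]
  gcongr

lemma mul_log_div_eq_negMulLog {x y : ℝ} (hx : 0 ≤ x) (h : 0 < x → 0 < y) :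
    x * Real.log (x / y) = -Real.negMulLog x - x * Real.log y := by
  rcases hx.eq_or_lt with rfl | hx
  · simp
  · rw [Real.log_div hx.ne' (h hx).ne', Real.negMulLog]
    ring

/-- The entropy form is continuous up to the boundary of the simplex, where the quotients in `kl`
are not. -/
lemma phi_eq_negMulLog {p q : X → ℝ} (hp : p ∈ stdSimplex ℝ X) (hq : q ∈ stdSimplex ℝ X) {u : ℝ}
    (hu : 0 ≤ u) : phi p q u = ∑ a, ((1 + u) * Real.negMulLog ((p a + u * q a) / (1 + u)) -
      Real.negMulLog (p a) - u * Real.negMulLog (q a)) := by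
  rcases hu.eq_or_lt with rfl | hu
  · simp [phi_zero]
  simp only [phi, kl, Finset.mul_sum]
  rw [← Finset.sum_add_distrib]
  refine Finset.sum_congr rfl fun a _ => ?_
  rw [mul_log_div_eq_negMulLog (hp.1 a) (dominates_blend_left hq hu.le a),
    mul_log_div_eq_negMulLog (hq.1 a) (dominates_blend_right hp hu a)]
  simp only [blend, Real.negMulLog]
  field_simp
  ring

lemma continuousOn_phi_left {p q : X → ℝ} (hp : p ∈ stdSimplex ℝ X) (hq : q ∈ stdSimplex ℝ X) :
    ContinuousOn (phi p q) (Set.Ici 0) := by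
  refine ContinuousOn.congr ?_ fun u hu => phi_eq_negMulLog hp hq hu
  refine continuousOn_finsetSum _ fun a _ => ?_
  have : ContinuousOn (fun u => (p a + u * q a) / (1 + u)) (Set.Ici 0) := by
    refine ContinuousOn.div (by fun_prop) (by fun_prop) fun u hu => ?_
    have : (0 : ℝ) ≤ u := hu
    positivity
  have := Real.continuous_negMulLog.comp_continuousOn this
  simp only [Function.comp_def] at this
  fun_prop

lemma continuousOn_phi_right {u : ℝ} (hu : 0 ≤ u) :
    ContinuousOn (fun z : (X → ℝ) × (X → ℝ) => phi z.1 z.2 u)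
      (stdSimplex ℝ X ×ˢ stdSimplex ℝ X) := by
  refine ContinuousOn.congr ?_ fun z hz => phi_eq_negMulLog hz.1 hz.2 hu
  refine Continuous.continuousOn ?_
  have := Real.continuous_negMulLog
  fun_prop

end Divergence

/-! ### Bhattacharyya coefficients -/

section Bhattacharyya

variable {X : Type*} [Fintype X]

/-- The Bhattacharyya coefficient `∑ p^η q^(1-η)` of order `η`. -/
def bhat (η : ℝ) (p q : X → ℝ) : ℝ := ∑ a, p a ^ η * q a ^ (1 - η)

lemma bhat_nonneg {η : ℝ} {p q : X → ℝ} (hp : p ∈ stdSimplex ℝ X) (hq : q ∈ stdSimplex ℝ X) :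
    0 ≤ bhat η p q :=
  Finset.sum_nonneg fun a _ => mul_nonneg (Real.rpow_nonneg (hp.1 a) _)
    (Real.rpow_nonneg (hq.1 a) _)

lemma bhat_le_one {η : ℝ} (h0 : 0 ≤ η) (h1 : η ≤ 1) {p q : X → ℝ} (hp : p ∈ stdSimplex ℝ X)
    (hq : q ∈ stdSimplex ℝ X) : bhat η p q ≤ 1 := by
  have := Finset.sum_le_sum fun a (_ : a ∈ Finset.univ) =>
    Real.geom_mean_le_arith_mean2_weighted h0 (sub_nonneg.2 h1) (hp.1 a) (hq.1 a)
      (add_sub_cancel η 1)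
  rw [Finset.sum_add_distrib, ← Finset.mul_sum, ← Finset.mul_sum, hp.2, hq.2] at this
  simp only [bhat]
  linarith

lemma bhat_lt_one {η : ℝ} (h0 : 0 < η) (h1 : η < 1) {p q : X → ℝ} (hp : p ∈ stdSimplex ℝ X)
    (hq : q ∈ stdSimplex ℝ X) (hne : p ≠ q) : bhat η p q < 1 := by
  obtain ⟨b, hb⟩ := Function.ne_iff.1 hne
  have := Finset.sum_lt_sum (fun a (_ : a ∈ Finset.univ) =>
    Real.geom_mean_le_arith_mean2_weighted h0.le (sub_nonneg.2 h1.le) (hp.1 a) (hq.1 a)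
      (add_sub_cancel η 1)) ⟨b, Finset.mem_univ b,
      (Real.geom_mean_lt_arith_mean2_weighted_iff_of_pos h0 (sub_pos.2 h1) (hp.1 b) (hq.1 b)
        (add_sub_cancel η 1)).2 hb⟩
  rw [Finset.sum_add_distrib, ← Finset.mul_sum, ← Finset.mul_sum, hp.2, hq.2] at this
  simp only [bhat]
  linarith

lemma continuous_bhat {η : ℝ} (h1 : η < 1) (p : X → ℝ) : Continuous (bhat η p) := by
  refine continuous_finsetSum _ fun a _ => continuous_const.mul ?_
  exact (continuous_apply a).rpow_const fun _ => Or.inr (sub_pos.2 h1).le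

/-- Jensen for `exp` under the weights `p`, since `p^η m^(1-η) = p exp(-(1-η) log (p/m))` where `p >
0`. -/
lemma exp_neg_kl_le_bhat {η : ℝ} {p m : X → ℝ} (hp : p ∈ stdSimplex ℝ X)
    (hm : m ∈ stdSimplex ℝ X) (h : Dominates m p) :
    Real.exp (-(1 - η) * kl p m) ≤ bhat η p m := by
  have := convexOn_exp.map_sum_le (t := Finset.univ) (w := p)
    (p := fun a => -(1 - η) * Real.log (p a / m a)) (fun a _ => hp.1 a) hp.2
    (fun _ _ => Set.mem_univ _)
  have e : ∑ a, p a • (-(1 - η) * Real.log (p a / m a)) = -(1 - η) * kl p m := by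
    simp only [kl, Finset.mul_sum, smul_eq_mul]
    exact Finset.sum_congr rfl fun a _ => by ring
  rw [e] at this
  refine this.trans (Finset.sum_le_sum fun a _ => ?_)
  rcases (hp.1 a).eq_or_lt with h0 | h0
  · rw [← h0, zero_smul]
    exact mul_nonneg (Real.rpow_nonneg le_rfl _) (Real.rpow_nonneg (hm.1 a) _)
  · have hma := h a h0
    refine le_of_eq ?_
    rw [smul_eq_mul, Real.log_div h0.ne' hma.ne', Real.rpow_def_of_pos h0, Real.rpow_def_of_pos hma,
      ← Real.exp_add]
    nth_rewrite 1 [← Real.exp_log h0]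
    rw [← Real.exp_add]
    congr 1
    ring

/-- As `u` grows the mixture tends to `q`. The limit is taken in `bhat`, which is continuous, and
not in `kl p`, which may blow up at `q`. The slack is `(1 - η) γ < γ`. -/
lemma exists_lt_phi {η γ : ℝ} (h0 : 0 < η) (h1 : η < 1) (hγ : 0 < γ) {p q : X → ℝ}
    (hp : p ∈ stdSimplex ℝ X) (hq : q ∈ stdSimplex ℝ X) (hb : bhat η p q ≤ Real.exp (-γ)) :
    ∃ u, 0 < u ∧ γ < phi p q u := by
  have hlim : Tendsto (fun u : ℝ => blend p q u) atTop (𝓝 q) := by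
    refine tendsto_pi_nhds.2 fun a => ?_
    have h1 : Tendsto (fun u : ℝ => (p a - q a) / (1 + u) + q a) atTop (𝓝 (0 + q a)) :=
      ((tendsto_const_nhds.div_atTop (tendsto_atTop_add_const_left _ 1 tendsto_id))).add_const _
    rw [zero_add] at h1
    refine h1.congr' ?_
    filter_upwards [eventually_gt_atTop 0] with u hu
    simp only [blend]
    field_simp
    ring
  have hlt : bhat η p q < Real.exp (-(1 - η) * γ) :=
    hb.trans_lt (Real.exp_lt_exp.2 (by nlinarith))
  have hev := (((continuous_bhat h1 p).tendsto q).comp hlim).eventually (gt_mem_nhds hlt)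
  obtain ⟨u, hu, hu0⟩ := (hev.and (eventually_gt_atTop 0)).exists
  refine ⟨u, hu0, ?_⟩
  have hm := blend_mem hp hq hu0.le
  have hd : Dominates (blend p q u) p := dominates_blend_left hq hu0.le
  have h2 := Real.exp_lt_exp.1 ((exp_neg_kl_le_bhat hp hm hd).trans_lt hu)
  have h3 : γ < kl p (blend p q u) := by nlinarith
  have h4 := kl_nonneg hq hm (dominates_blend_right hp hu0)
  simp only [phi]
  nlinarith

lemma ne_of_bhat_lt {η γ : ℝ} (hγ : 0 < γ) {p q : X → ℝ}
    (hp : p ∈ stdSimplex ℝ X) (hb : bhat η p q ≤ Real.exp (-γ)) : p ≠ q := by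
  rintro rfl
  have h1 : bhat η p p = 1 := by
    rw [← hp.2]
    refine Finset.sum_congr rfl fun a _ => ?_
    rcases (hp.1 a).eq_or_lt with h0 | h0
    · rcases eq_or_ne η 0 with rfl | h
      · simp [← h0]
      · simp [← h0, h]
    · rw [← Real.rpow_add h0, add_sub_cancel, Real.rpow_one]
  have := (Real.exp_lt_exp.2 (neg_neg_of_pos hγ)).trans_eq Real.exp_zero
  linarith

/-- Existence and uniqueness of the root of `phi p q u = γ`. -/
lemma exists_phi_eq {η γ : ℝ} (h0 : 0 < η) (h1 : η < 1) (hγ : 0 < γ) {p q : X → ℝ}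
    (hp : p ∈ stdSimplex ℝ X) (hq : q ∈ stdSimplex ℝ X) (hb : bhat η p q ≤ Real.exp (-γ)) :
    ∃ u, 0 < u ∧ phi p q u = γ := by
  obtain ⟨U, hU, hγU⟩ := exists_lt_phi h0 h1 hγ hp hq hb
  obtain ⟨u, hu, h⟩ := intermediate_value_Icc hU.le
    ((continuousOn_phi_left hp hq).mono Set.Icc_subset_Ici_self)
    (show γ ∈ Set.Icc (phi p q 0) (phi p q U) from ⟨by rw [phi_zero]; exact hγ.le, hγU.le⟩)
  refine ⟨u, lt_of_le_of_ne hu.1 ?_, h⟩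
  rintro rfl
  rw [phi_zero] at h
  exact hγ.ne h

lemma bhat_pow_le {N k : ℕ} {η : ℝ} (h0 : 0 < η) (h1 : η < 1) {Q q : X → ℝ} (hQ : Q ∈ stdSimplex ℝ X)
    (hq : q ∈ stdSimplex ℝ X) {K : ℕ} (hK : K * N ≤ k) :
    bhat η Q q ^ k ≤ (bhat η Q q ^ K) ^ N := by
  rw [← pow_mul]
  exact pow_le_pow_of_le_one (bhat_nonneg hQ hq) (bhat_le_one h0.le h1.le hQ hq) hK

/-- A power of `bhat η q` kills everything away from `q`, where `bhat η p` is at most `e^{-γ}`. -/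
lemma exists_pow_bhat_le {η γ ε : ℝ} (h0 : 0 < η) (h1 : η < 1) (hε : 0 < ε) {p q : X → ℝ}
    (hp : p ∈ stdSimplex ℝ X) (hq : q ∈ stdSimplex ℝ X) (hb : bhat η p q ≤ Real.exp (-γ)) :
    ∃ K : ℕ, ∀ V ∈ stdSimplex ℝ X, bhat η p V * bhat η q V ^ K ≤ Real.exp (-(γ - ε)) := by
  -- On this compact set `bhat η p` is too large; it misses `q`, so `bhat η q` stays below some `r <
  -- 1` there.
  set S := stdSimplex ℝ X ∩ {V | Real.exp (-(γ - ε)) ≤ bhat η p V} with hS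
  have hcomp : IsCompact S := (isCompact_stdSimplex ℝ X).inter_right
    (isClosed_le continuous_const (continuous_bhat h1 p))
  have hlt : bhat η p q < Real.exp (-(γ - ε)) := hb.trans_lt (Real.exp_lt_exp.2 (by linarith))
  obtain ⟨r, hr0, hr1, hr⟩ : ∃ r : ℝ, 0 ≤ r ∧ r < 1 ∧ ∀ V ∈ S, bhat η q V ≤ r := by
    rcases S.eq_empty_or_nonempty with he | hne
    · exact ⟨0, le_rfl, one_pos, by simp [he]⟩
    · obtain ⟨V, hV, hmax⟩ := hcomp.exists_isMaxOn hne (continuous_bhat h1 q).continuousOn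
      refine ⟨bhat η q V, bhat_nonneg hq hV.1, bhat_lt_one h0 h1 hq hV.1 ?_, fun W hW => hmax hW⟩
      rintro rfl
      exact absurd hV.2 (not_le.2 hlt)
  obtain ⟨K, hK⟩ := exists_pow_lt_of_lt_one (Real.exp_pos (-(γ - ε))) hr1
  refine ⟨K, fun V hV => ?_⟩
  have hB0 := bhat_nonneg (η := η) hp hV
  have hC0 := bhat_nonneg (η := η) hq hV
  by_cases hVS : Real.exp (-(γ - ε)) ≤ bhat η p V
  · calc _ ≤ 1 * r ^ K := by
          gcongr
          · exact bhat_le_one h0.le h1.le hp hV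
          · exact hr V ⟨hV, hVS⟩
      _ ≤ _ := by linarith
  · calc _ ≤ bhat η p V * 1 := by
          gcongr
          exact pow_le_one₀ hC0 (bhat_le_one h0.le h1.le hq hV)
      _ ≤ _ := by linarith

/-- If `phi P Q c > γ`, pairs with `phi p q c ≤ γ` are uniformly far from `(P, Q)`. -/
lemma exists_bhat_mul_le {γ c : ℝ} (hc : 0 < c) {P Q : X → ℝ} (hP : P ∈ stdSimplex ℝ X)
    (hQ : Q ∈ stdSimplex ℝ X) (h : γ < phi P Q c) :
    ∃ r : ℝ, 0 < r ∧ r < 1 ∧ ∀ p ∈ stdSimplex ℝ X, ∀ q ∈ stdSimplex ℝ X, phi p q c ≤ γ →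
      bhat (1 / 2) P p * bhat (1 / 2) Q q ^ c ≤ r := by
  set S := (stdSimplex ℝ X ×ˢ stdSimplex ℝ X) ∩
    (fun z : (X → ℝ) × (X → ℝ) => phi z.1 z.2 c) ⁻¹' Set.Iic γ with hS
  have hcs := (isCompact_stdSimplex ℝ X).prod (isCompact_stdSimplex ℝ X)
  have hcomp : IsCompact S := hcs.of_isClosed_subset
    ((continuousOn_phi_right hc.le).preimage_isClosed_of_isClosed hcs.isClosed isClosed_Iic)
    Set.inter_subset_left
  have hcont : Continuous fun z : (X → ℝ) × (X → ℝ) =>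
      bhat (1 / 2) P z.1 * bhat (1 / 2) Q z.2 ^ c :=
    ((continuous_bhat (by norm_num) P).comp continuous_fst).mul
      (((continuous_bhat (by norm_num) Q).comp continuous_snd).rpow_const
        fun _ => Or.inr hc.le)
  rcases S.eq_empty_or_nonempty with he | hne
  · refine ⟨1 / 2, by norm_num, by norm_num, fun p hp q hq hpq => ?_⟩
    have : (p, q) ∈ S := ⟨⟨hp, hq⟩, hpq⟩
    simp [he] at this
  · obtain ⟨z, hz, hmax⟩ := hcomp.exists_isMaxOn hne hcont.continuousOn
    have hlt : bhat (1 / 2) P z.1 * bhat (1 / 2) Q z.2 ^ c < 1 := by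
      have hB0 := bhat_nonneg (η := 1 / 2) hP hz.1.1
      have hB1 := bhat_le_one (η := 1 / 2) (by norm_num) (by norm_num) hP hz.1.1
      have hC0 := bhat_nonneg (η := 1 / 2) hQ hz.1.2
      have hC1 := bhat_le_one (η := 1 / 2) (by norm_num) (by norm_num) hQ hz.1.2
      by_cases h1 : P = z.1
      · by_cases h2 : Q = z.2
        · have := hz.2
          simp only [Set.mem_preimage, Set.mem_Iic, ← h1, ← h2] at this
          exact absurd this (not_le.2 h)
        · refine mul_lt_one_of_nonneg_of_lt_one_right hB1 (by positivity) ?_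
          exact Real.rpow_lt_one hC0 (bhat_lt_one (by norm_num) (by norm_num) hQ hz.1.2 h2) hc
      · refine mul_lt_one_of_nonneg_of_lt_one_left hB0
          (bhat_lt_one (by norm_num) (by norm_num) hP hz.1.1 h1) ?_
        exact Real.rpow_le_one hC0 hC1 hc.le
    -- The maximum with `0` keeps `r` positive, so that `-Real.log r` can serve as a decay rate.
    obtain ⟨r, hr1, hr2⟩ := exists_between (max_lt hlt one_pos)
    refine ⟨r, (le_max_right _ _).trans_lt hr1, hr2, fun p hp q hq hpq => ?_⟩
    have : (p, q) ∈ S := ⟨⟨hp, hq⟩, hpq⟩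
    exact (hmax this).trans ((le_max_left _ _).trans hr1.le)

end Bhattacharyya

/-! ### Empirical distributions and likelihoods -/

section Types

variable {X : Type*} {n : ℕ}

/-- The likelihood of a sequence under independent sampling from `f`. -/
def lik (f : X → ℝ) (x : Fin n → X) : ℝ := ∏ k, f (x k)

lemma lik_nonneg {f : X → ℝ} (hf : ∀ a, 0 ≤ f a) (x : Fin n → X) : 0 ≤ lik f x :=
  Finset.prod_nonneg fun _ _ => hf _

variable [DecidableEq X]

/-- The maximal likelihood of a sequence, attained by its empirical distribution. -/
def maxLik (x : Fin n → X) : ℝ := lik (empDist x) x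

lemma empDist_apply_pos {n : ℕ} (x : Fin n → X) (k : Fin n) : 0 < empDist x (x k) := by
  have hn : 0 < n := k.pos
  have : (1 : ℝ) ≤ ∑ l, if x l = x k then 1 else 0 := by
    refine le_trans (by simp) (Finset.single_le_sum (f := fun l => if x l = x k then (1 : ℝ) else 0)
      (fun l _ => by positivity) (Finset.mem_univ k))
  simp only [empDist]
  positivity

lemma exists_of_empDist_pos {n : ℕ} {x : Fin n → X} {a : X} (h : 0 < empDist x a) :
    ∃ k, x k = a := by
  by_contra! hne
  simp [empDist, hne] at h

lemma dominates_of_lik_ne_zero {n : ℕ} {x : Fin n → X} {P : X → ℝ} (hP : ∀ a, 0 ≤ P a)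
    (h : lik P x ≠ 0) : Dominates P (empDist x) := by
  intro a ha
  obtain ⟨k, rfl⟩ := exists_of_empDist_pos ha
  exact lt_of_le_of_ne (hP _) fun h0 => h (Finset.prod_eq_zero (Finset.mem_univ k) h0.symm)

lemma maxLik_pos (x : Fin n → X) : 0 < maxLik x := by
  rw [maxLik, lik]
  exact Finset.prod_pos fun k _ => empDist_apply_pos x k

variable [Fintype X]

lemma sum_eq_empDist (hn : 0 < n) (x : Fin n → X) (f : X → ℝ) :
    ∑ k, f (x k) = n * ∑ a, empDist x a * f a := by
  have hn' : (n : ℝ) ≠ 0 := by positivity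
  simp only [empDist, Finset.mul_sum, Finset.sum_mul]
  rw [Finset.sum_comm]
  refine Finset.sum_congr rfl fun k _ => ?_
  rw [Finset.sum_eq_single (x k)]
  · simp [hn']
  · intro a _ ha
    simp [ha.symm]
  · simp

lemma empDist_mem (hn : 0 < n) (x : Fin n → X) : empDist x ∈ stdSimplex ℝ X := by
  refine ⟨fun a => ?_, ?_⟩
  · simp only [empDist]
    positivity
  · have h := sum_eq_empDist hn x fun _ => 1
    simp only [Finset.sum_const, Finset.card_univ, Fintype.card_fin, nsmul_eq_mul, mul_one] at h
    have hn' : (0 : ℝ) < n := by positivity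
    nlinarith

lemma lik_eq_exp {V : X → ℝ} (hn : 0 < n) (x : Fin n → X) (hV : Dominates V (empDist x)) :
    lik V x = Real.exp (-(n * kl (empDist x) V)) * maxLik x := by
  rw [kl, ← sum_eq_empDist hn x fun a => Real.log (empDist x a / V a), ← Finset.sum_neg_distrib,
    Real.exp_sum, maxLik, lik, lik, ← Finset.prod_mul_distrib]
  refine Finset.prod_congr rfl fun k _ => ?_
  have h1 := empDist_apply_pos x k
  have h2 := hV _ h1
  rw [← Real.log_inv, Real.exp_log (by positivity)]
  field_simp

/-- AM-GM for the ratios `h / empDist x` along the sequence. The weight `h` is not normalized: it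
will be `P^η V^(1-η)`, whose mass is `bhat`. -/
lemma lik_le (hn : 0 < n) (x : Fin n → X) {h : X → ℝ} (hh : ∀ a, 0 ≤ h a) :
    lik h x ≤ (∑ a, h a) ^ n * maxLik x := by
  have hn' : (n : ℝ) ≠ 0 := by positivity
  have h0 : ∀ k, 0 ≤ h (x k) / empDist x (x k) := fun k =>
    div_nonneg (hh _) (empDist_apply_pos x k).le
  have h1 := Real.geom_mean_le_arith_mean_weighted Finset.univ (fun _ : Fin n => (n : ℝ)⁻¹)
    (fun k => h (x k) / empDist x (x k)) (fun _ _ => by positivity) (by simp [hn'])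
    (fun k _ => h0 k)
  rw [Real.finsetProd_rpow _ _ fun k _ => h0 k, ← Finset.mul_sum,
    sum_eq_empDist hn x fun a => h a / empDist x a, ← mul_assoc, inv_mul_cancel₀ hn', one_mul] at h1
  have h2 : ∑ a, empDist x a * (h a / empDist x a) ≤ ∑ a, h a := by
    refine Finset.sum_le_sum fun a _ => ?_
    rcases eq_or_ne (empDist x a) 0 with h | h
    · simpa [h] using hh a
    · rw [mul_div_cancel₀ _ h]
  have h3 := pow_le_pow_left₀ (Real.rpow_nonneg (Finset.prod_nonneg fun k _ => h0 k) _)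
    (h1.trans h2) n
  rw [Real.rpow_inv_natCast_pow (Finset.prod_nonneg fun k _ => h0 k) hn.ne',
    Finset.prod_div_distrib] at h3
  exact (div_le_iff₀ (maxLik_pos x)).1 h3

lemma lik_bhat_le (hn : 0 < n) (x : Fin n → X) {η : ℝ} {P V : X → ℝ} (hP : ∀ a, 0 ≤ P a)
    (hV : ∀ a, 0 ≤ V a) :
    lik P x ^ η * lik V x ^ (1 - η) ≤ bhat η P V ^ n * maxLik x := by
  rw [lik, lik, ← Real.finsetProd_rpow _ _ fun k _ => hP _,
    ← Real.finsetProd_rpow _ _ fun k _ => hV _, ← Finset.prod_mul_distrib]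
  exact lik_le hn x (h := fun a => P a ^ η * V a ^ (1 - η)) fun a =>
    mul_nonneg (Real.rpow_nonneg (hP a) _) (Real.rpow_nonneg (hV a) _)

/-- The number of types is polynomial, so maximal likelihoods have a polynomial sum. -/
lemma sum_maxLik_le (n : ℕ) :
    ∑ x : Fin n → X, maxLik x ≤ ((n : ℝ) + 1) ^ Fintype.card X := by
  let cnt : (Fin n → X) → (X → Fin (n + 1)) := fun x a =>
    ⟨(Finset.univ.filter fun k => x k = a).card,
      Nat.lt_succ_of_le ((Finset.card_filter_le _ _).trans (by simp))⟩
  let dist : (X → Fin (n + 1)) → X → ℝ := fun t a => 1 / (n : ℝ) * ((t a : ℕ) : ℝ)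
  have hdist : ∀ x, empDist x = dist (cnt x) := by
    intro x
    funext a
    simp [empDist, dist, cnt]
  -- Sequences of one type share their empirical distribution, so their maximal likelihoods add up
  -- to a probability under it.
  have hfib : ∀ t : X → Fin (n + 1),
      ∑ x ∈ Finset.univ.filter (fun x => cnt x = t), maxLik x ≤ 1 := by
    intro t
    rcases (Finset.univ.filter (fun x => cnt x = t)).eq_empty_or_nonempty with he | ⟨x₀, hx₀⟩
    · simp [he]
    · have ht : cnt x₀ = t := by simpa using hx₀
      have hpos : ∀ a, 0 ≤ dist t a := fun a => by positivity
      calc _ = ∑ x ∈ Finset.univ.filter (fun x => cnt x = t), ∏ k, dist t (x k) := by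
            refine Finset.sum_congr rfl fun x hx => ?_
            have hx : cnt x = t := by simpa using hx
            rw [maxLik, lik, hdist, hx]
        _ ≤ ∑ x : Fin n → X, ∏ k, dist t (x k) :=
            Finset.sum_le_sum_of_subset_of_nonneg (Finset.filter_subset _ _)
              fun x _ _ => Finset.prod_nonneg fun k _ => hpos _
        _ = (∑ a, dist t a) ^ n := by
            rw [← Fintype.piFinset_univ, ← Finset.prod_univ_sum]
            simp
        _ = 1 := by
            rcases n.eq_zero_or_pos with rfl | hn
            · simp
            · rw [← ht, ← hdist, (empDist_mem hn x₀).2, one_pow]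
  rw [← Finset.sum_fiberwise_of_maps_to (t := Finset.univ) (g := cnt) fun _ _ => Finset.mem_univ _]
  refine (Finset.sum_le_sum fun t _ => hfib t).trans ?_
  simp

end Types

/-! ### Likelihood bounds on the events of the test -/

section Score

variable {X : Type*} [Fintype X] [DecidableEq X] {N k : ℕ}

/-- The statistic `k GJS` of a training and a test sequence. -/
def pairScore (x : Fin N → X) (y : Fin k → X) : ℝ :=
  k * gjs (empDist x) (empDist y) ((N : ℝ) / k)

lemma pairScore_eq (hN : 0 < N) (hk : 0 < k) (x : Fin N → X) (y : Fin k → X) :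
    pairScore x y = N * phi (empDist x) (empDist y) ((k : ℝ) / N) := by
  have hu : (0 : ℝ) < (k : ℝ) / N := by positivity
  rw [pairScore, ← inv_div (k : ℝ) N, gjs_inv _ _ hu]
  field_simp

lemma lik_mul_lik_eq (hN : 0 < N) (hk : 0 < k) (x : Fin N → X) (y : Fin k → X) {V : X → ℝ}
    (hx : Dominates V (empDist x)) (hy : Dominates V (empDist y)) :
    lik V x * lik V y =
      Real.exp (-(N * (kl (empDist x) V + (k : ℝ) / N * kl (empDist y) V))) *
        (maxLik x * maxLik y) := by
  rw [lik_eq_exp hN x hx, lik_eq_exp hk y hy]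
  have : -(N * (kl (empDist x) V + (k : ℝ) / N * kl (empDist y) V)) =
      -(N * kl (empDist x) V) + -(k * kl (empDist y) V) := by
    field_simp
    ring
  rw [this, Real.exp_add]
  ring

/-- A common source rarely produces a large score. -/
lemma lik_le_of_le_score (hN : 0 < N) (hk : 0 < k) {γ : ℝ} {P : X → ℝ}
    (hP : P ∈ stdSimplex ℝ X) (x : Fin N → X) (y : Fin k → X) (h : γ * N ≤ pairScore x y) :
    lik P x * lik P y ≤ Real.exp (-(γ * N)) * (maxLik x * maxLik y) := by
  have hM := mul_pos (maxLik_pos x) (maxLik_pos y)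
  by_cases hx : lik P x = 0
  · rw [hx, zero_mul]
    positivity
  by_cases hy : lik P y = 0
  · rw [hy, mul_zero]
    positivity
  have hdx := dominates_of_lik_ne_zero hP.1 hx
  have hdy := dominates_of_lik_ne_zero hP.1 hy
  rw [lik_mul_lik_eq hN hk x y hdx hdy]
  refine mul_le_mul_of_nonneg_right (Real.exp_le_exp.2 (neg_le_neg ?_)) hM.le
  rw [pairScore_eq hN hk] at h
  refine h.trans (mul_le_mul_of_nonneg_left ?_ (Nat.cast_nonneg N))
  exact phi_le (empDist_mem hN x) (empDist_mem hk y) hP (by positivity) hdx hdy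

/-- Different sources rarely produce a small score after many test samples. -/
lemma lik_le_of_score_lt (hN : 0 < N) (hk : 0 < k) {γ ε η : ℝ} {P Q : X → ℝ} (h0 : 0 < η)
    (h1 : η < 1) (hP : P ∈ stdSimplex ℝ X) (hQ : Q ∈ stdSimplex ℝ X) {K : ℕ} (hK : K * N ≤ k)
    (hKb : ∀ V ∈ stdSimplex ℝ X, bhat η P V * bhat η Q V ^ K ≤ Real.exp (-(γ - η * ε)))
    (x : Fin N → X) (y : Fin k → X) (h : pairScore x y < γ * N) :
    lik P x * lik Q y ≤ Real.exp (-((γ - ε) * N)) * (maxLik x * maxLik y) := by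
  have hx := empDist_mem hN x
  have hy := empDist_mem hk y
  have hu : (0 : ℝ) < (k : ℝ) / N := by positivity
  set V := blend (empDist x) (empDist y) ((k : ℝ) / N) with hVdef
  have hV : V ∈ stdSimplex ℝ X := blend_mem hx hy hu.le
  have hM := mul_pos (maxLik_pos x) (maxLik_pos y)
  have hLP := lik_nonneg hP.1 x
  have hLQ := lik_nonneg hQ.1 y
  have hVV := lik_mul_lik_eq hN hk x y (dominates_blend_left hy hu.le : Dominates V _)
    (dominates_blend_right hx hu)
  change _ = Real.exp (-(N * phi (empDist x) (empDist y) ((k : ℝ) / N))) * _ at hVV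
  rw [← pairScore_eq hN hk] at hVV
  have hb1 := lik_bhat_le hN x (η := η) hP.1 hV.1
  have hb2 := lik_bhat_le hk y (η := η) hQ.1 hV.1
  have hβ : bhat η P V ^ N * bhat η Q V ^ k ≤ Real.exp (-(γ - η * ε) * N) := by
    calc _ ≤ bhat η P V ^ N * (bhat η Q V ^ K) ^ N := by
          gcongr
          · exact pow_nonneg (bhat_nonneg hP hV) _
          · exact bhat_pow_le h0 h1 hQ hV hK
      _ = (bhat η P V * bhat η Q V ^ K) ^ N := (mul_pow _ _ _).symm
      _ ≤ Real.exp (-(γ - η * ε)) ^ N := by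
          gcongr
          · exact mul_nonneg (bhat_nonneg hP hV) (pow_nonneg (bhat_nonneg hQ hV) _)
          · exact hKb V hV
      _ = _ := by rw [← Real.exp_nat_mul]; ring_nf
  have hVx := lik_nonneg hV.1 x
  have hVy := lik_nonneg hV.1 y
  -- Geometric interpolation between the true pair of laws and the common law `V`, whose likelihood
  -- is known exactly from the score.
  have h3 : (lik P x * lik Q y) ^ η * (lik V x * lik V y) ^ (1 - η) ≤
      Real.exp (-(γ - η * ε) * N) * (maxLik x * maxLik y) := by
    rw [Real.mul_rpow hLP hLQ, Real.mul_rpow hVx hVy]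
    calc _ = (lik P x ^ η * lik V x ^ (1 - η)) * (lik Q y ^ η * lik V y ^ (1 - η)) := by ring
      _ ≤ (bhat η P V ^ N * maxLik x) * (bhat η Q V ^ k * maxLik y) :=
          mul_le_mul hb1 hb2 (by positivity)
            (mul_nonneg (pow_nonneg (bhat_nonneg hP hV) _) (maxLik_pos x).le)
      _ = (bhat η P V ^ N * bhat η Q V ^ k) * (maxLik x * maxLik y) := by ring
      _ ≤ _ := by gcongr
  rw [hVV, Real.mul_rpow (Real.exp_pos _).le hM.le, ← Real.exp_mul] at h3
  -- Dividing by the power of the `V`-likelihood costs at most `e^((1-η)γN)`, and `-(γ - ηε) +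
  -- (1-η)γ = -η(γ - ε)`; the `η`-th root remains.
  have h4 : (lik P x * lik Q y) ^ η ≤
      (Real.exp (-((γ - ε) * N)) * (maxLik x * maxLik y)) ^ η := by
    have hc : 0 < Real.exp (-pairScore x y * (1 - η)) * (maxLik x * maxLik y) ^ (1 - η) := by
      positivity
    refine le_of_mul_le_mul_right (h3.trans ?_) hc
    rw [Real.mul_rpow (Real.exp_pos _).le hM.le, ← Real.exp_mul]
    have e1 : (maxLik x * maxLik y) = (maxLik x * maxLik y) ^ η * (maxLik x * maxLik y) ^ (1 - η) := by
      rw [← Real.rpow_add hM, add_sub_cancel, Real.rpow_one]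
    calc _ = Real.exp (-(γ - η * ε) * N) *
          ((maxLik x * maxLik y) ^ η * (maxLik x * maxLik y) ^ (1 - η)) := by rw [← e1]
      _ ≤ Real.exp (-((γ - ε) * N) * η + -pairScore x y * (1 - η)) *
          ((maxLik x * maxLik y) ^ η * (maxLik x * maxLik y) ^ (1 - η)) := by
          gcongr
          nlinarith
      _ = _ := by rw [Real.exp_add]; ring
  exact (Real.rpow_le_rpow_iff (by positivity) (by positivity) h0).1 h4

/-- Taking `V = empDist x` in `lik_bhat_le` bounds the square root of the likelihood; after
squaring, one of the two factors `bhat ^ n` is dropped. -/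
lemma lik_le_bhat_half {n : ℕ} (hn : 0 < n) (x : Fin n → X) {P : X → ℝ}
    (hP : P ∈ stdSimplex ℝ X) : lik P x ≤ bhat (1 / 2) P (empDist x) ^ n * maxLik x := by
  have hx := empDist_mem hn x
  have h := lik_bhat_le hn x (η := 1 / 2) hP.1 hx.1
  have hL := lik_nonneg hP.1 x
  have hM := maxLik_pos x
  have hB := bhat_nonneg (η := 1 / 2) hP hx
  have hB1 := bhat_le_one (η := 1 / 2) (by norm_num) (by norm_num) hP hx
  set B := bhat (1 / 2) P (empDist x)
  have hBn1 : B ^ n ≤ 1 := pow_le_one₀ hB hB1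
  have hBn0 : 0 ≤ B ^ n := pow_nonneg hB n
  rw [show (1 : ℝ) - 1 / 2 = 1 / 2 by norm_num, ← Real.sqrt_eq_rpow, ← Real.sqrt_eq_rpow,
    ← maxLik] at h
  have e : maxLik x = √(maxLik x) * √(maxLik x) := (Real.mul_self_sqrt hM.le).symm
  have hs := Real.sqrt_pos.2 hM
  have h2 : √(lik P x) ≤ B ^ n * √(maxLik x) := by
    refine le_of_mul_le_mul_right ?_ hs
    rw [mul_assoc, ← e]
    exact h
  calc lik P x = √(lik P x) * √(lik P x) := (Real.mul_self_sqrt hL).symm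
    _ ≤ (B ^ n * √(maxLik x)) * (B ^ n * √(maxLik x)) :=
        mul_le_mul h2 h2 (Real.sqrt_nonneg _) (by positivity)
    _ = (B ^ n * B ^ n) * maxLik x := by rw [mul_mul_mul_comm, ← e]
    _ ≤ (B ^ n * 1) * maxLik x := by gcongr
    _ = _ := by rw [mul_one]

/-- Different sources rarely produce a small score once the expected score has passed the
threshold. -/
lemma lik_le_of_score_lt_of_bhat (hN : 0 < N) (hk : 0 < k) {γ c r : ℝ} {P Q : X → ℝ} (hc : 0 < c)
    (hP : P ∈ stdSimplex ℝ X) (hQ : Q ∈ stdSimplex ℝ X) (hck : c * N ≤ k)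
    (hr : ∀ p ∈ stdSimplex ℝ X, ∀ q ∈ stdSimplex ℝ X, phi p q c ≤ γ →
      bhat (1 / 2) P p * bhat (1 / 2) Q q ^ c ≤ r)
    (x : Fin N → X) (y : Fin k → X) (h : pairScore x y < γ * N) :
    lik P x * lik Q y ≤ r ^ N * (maxLik x * maxLik y) := by
  have hx := empDist_mem hN x
  have hy := empDist_mem hk y
  have hM := mul_pos (maxLik_pos x) (maxLik_pos y)
  have hN' : (0 : ℝ) < N := by positivity
  rw [pairScore_eq hN hk, mul_comm γ, mul_lt_mul_iff_right₀ hN'] at h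
  -- Monotonicity moves `k / N` down to `c`, so one compact set of pairs serves all `k ≥ c N`.
  have hphi := (phi_mono hx hy hc ((le_div_iff₀ hN').2 hck)).trans h.le
  have hr := hr _ hx _ hy hphi
  have hB := bhat_nonneg (η := 1 / 2) hP hx
  have hC := bhat_nonneg (η := 1 / 2) hQ hy
  have hC1 := bhat_le_one (η := 1 / 2) (by norm_num) (by norm_num) hQ hy
  have h1 := lik_le_bhat_half hN x hP
  have h2 := lik_le_bhat_half hk y hQ
  set B := bhat (1 / 2) P (empDist x)
  set C := bhat (1 / 2) Q (empDist y)
  have h3 : C ^ k ≤ (C ^ c) ^ N := by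
    rcases hC.eq_or_lt with h0 | h0
    · rw [← h0, zero_pow hk.ne']
      positivity
    · rw [← Real.rpow_natCast, ← Real.rpow_natCast, ← Real.rpow_mul hC]
      exact Real.rpow_le_rpow_of_exponent_ge h0 hC1 hck
  calc _ ≤ (B ^ N * maxLik x) * (C ^ k * maxLik y) :=
        mul_le_mul h1 h2 (lik_nonneg hQ.1 y) (mul_nonneg (pow_nonneg hB _) (maxLik_pos x).le)
    _ = (B ^ N * C ^ k) * (maxLik x * maxLik y) := by ring
    _ ≤ (B ^ N * (C ^ c) ^ N) * (maxLik x * maxLik y) := by gcongr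
    _ = (B * C ^ c) ^ N * (maxLik x * maxLik y) := by rw [mul_pow]
    _ ≤ _ := by gcongr

end Score

/-! ### Chernoff information -/

section Chernoff

variable {X : Type*}

lemma ofReal_mass (P : PMF X) (a : X) : ENNReal.ofReal (mass P a) = P a :=
  ENNReal.ofReal_toReal (P.apply_ne_top a)

variable [Fintype X]

lemma mass_mem (P : PMF X) : mass P ∈ stdSimplex ℝ X := by
  refine ⟨fun a => ENNReal.toReal_nonneg, ?_⟩
  simp only [mass]
  rw [← ENNReal.toReal_sum fun a _ => P.apply_ne_top a, ← tsum_fintype (L := .unconditional _),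
    P.tsum_coe, ENNReal.toReal_one]

lemma sum_rpow_eq_bhat (P Q : PMF X) {η : ℝ} (h0 : 0 ≤ η) (h1 : η ≤ 1) :
    ∑ x, P x ^ η * Q x ^ (1 - η) = ENNReal.ofReal (bhat η (mass P) (mass Q)) := by
  have hP := (mass_mem P).1
  have hQ := (mass_mem Q).1
  rw [bhat, ENNReal.ofReal_sum_of_nonneg fun a _ =>
    mul_nonneg (Real.rpow_nonneg (hP a) _) (Real.rpow_nonneg (hQ a) _)]
  refine Finset.sum_congr rfl fun a _ => ?_
  rw [ENNReal.ofReal_mul (Real.rpow_nonneg (hP a) _), ← ENNReal.ofReal_rpow_of_nonneg (hP a) h0,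
    ← ENNReal.ofReal_rpow_of_nonneg (hQ a) (sub_nonneg.2 h1), ofReal_mass, ofReal_mass]

lemma le_exp_of_log_ofReal_le {r t : ℝ} (h : ENNReal.log (ENNReal.ofReal r) ≤ (t : EReal)) :
    r ≤ Real.exp t := by
  by_contra! hlt
  have hr := (Real.exp_pos t).trans hlt
  rw [ENNReal.log_ofReal_of_pos hr, EReal.coe_le_coe_iff, Real.log_le_iff_le_exp hr] at h
  exact absurd h (not_le.2 hlt)

/-- As `0 ^ 0 = 1`, a symbol charged by only one distribution makes its term jump at an endpoint;
equal supports exclude this. -/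
lemma continuous_bhat_order {p q : X → ℝ} (hp : ∀ a, 0 ≤ p a)
    (hq : ∀ a, 0 ≤ q a) (h : ∀ a, p a = 0 ↔ q a = 0) :
    ContinuousOn (fun η => bhat η p q) (Set.Icc 0 1) := by
  refine continuousOn_finsetSum _ fun a _ => ?_
  rcases (hp a).eq_or_lt with h0 | h0
  · have h1 : q a = 0 := (h a).1 h0.symm
    refine (continuousOn_const (c := (0 : ℝ))).congr fun η hη => ?_
    simp only [← h0, h1]
    rcases eq_or_ne η 0 with rfl | hne
    · simp
    · simp [hne]
  · have h1 : 0 < q a := lt_of_le_of_ne (hq a) fun h1 => h0.ne' ((h a).2 h1.symm)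
    refine Continuous.continuousOn ?_
    exact (Real.continuous_const_rpow h0.ne').mul
      ((Real.continuous_const_rpow h1.ne').comp (by fun_prop))

/-- A positive level not exceeding the Chernoff information is reached at an interior order. -/
lemma exists_bhat_le {P Q : PMF X} {γ : ℝ} (hγ : 0 < γ) (h : (γ : EReal) ≤ chernoff P Q)
    (hs : (γ : EReal) = chernoff P Q → P.support = Q.support) :
    ∃ η : ℝ, 0 < η ∧ η < 1 ∧ bhat η (mass P) (mass Q) ≤ Real.exp (-γ) := by
  have hP := mass_mem P
  have hQ := mass_mem Q
  obtain ⟨η, hη, hb⟩ : ∃ η ∈ Set.Icc (0 : ℝ) 1, bhat η (mass P) (mass Q) ≤ Real.exp (-γ) := by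
    -- Below the Chernoff information some order works by definition of the infimum. At equality the
    -- infimum must be attained, which uses the equal supports.
    rcases h.lt_or_eq with hlt | heq
    · rw [chernoff, EReal.lt_neg_comm] at hlt
      obtain ⟨η, hη⟩ := iInf_lt_iff.1 hlt
      rw [sum_rpow_eq_bhat P Q η.2.1 η.2.2] at hη
      exact ⟨η, η.2, le_exp_of_log_ofReal_le (by exact_mod_cast hη.le)⟩
    · have hz : ∀ a, mass P a = 0 ↔ mass Q a = 0 := by
        intro a
        have : a ∈ P.support ↔ a ∈ Q.support := by rw [hs heq]
        rw [PMF.mem_support_iff, PMF.mem_support_iff, not_iff_not] at this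
        simp only [mass, ENNReal.toReal_eq_zero_iff, P.apply_ne_top, Q.apply_ne_top, or_false]
        exact this
      obtain ⟨η, hη, hmin⟩ := isCompact_Icc.exists_isMinOn (Set.nonempty_Icc.2 zero_le_one)
        (continuous_bhat_order hP.1 hQ.1 hz)
      refine ⟨η, hη, le_exp_of_log_ofReal_le ?_⟩
      have e : ((-γ : ℝ) : EReal) =
          ⨅ η : Set.Icc (0 : ℝ) 1, ENNReal.log (∑ x, P x ^ (η : ℝ) * Q x ^ (1 - (η : ℝ))) := by
        rw [EReal.coe_neg, heq, chernoff, neg_neg]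
      rw [e]
      refine le_iInf fun η' => ?_
      rw [sum_rpow_eq_bhat P Q η'.2.1 η'.2.2]
      exact ENNReal.log_le_log (ENNReal.ofReal_le_ofReal (hmin η'.2))
  -- At the orders `0` and `1` the coefficient equals `1`, so the order found is interior.
  have hlt := hb.trans_lt ((Real.exp_lt_exp.2 (neg_neg_of_pos hγ)).trans_eq Real.exp_zero)
  refine ⟨η, lt_of_le_of_ne hη.1 ?_, lt_of_le_of_ne hη.2 ?_, hb⟩
  · rintro rfl
    simp [bhat, hQ.2] at hlt
  · rintro rfl
    simp [bhat, hP.2] at hlt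

end Chernoff

/-! ### The law of one training sequence and the first test samples -/

section Law

variable {X : Type*} [Fintype X] [MeasurableSpace X] [DiscreteMeasurableSpace X]

lemma measurePreserving_prefix {Y : Type*} [MeasurableSpace Y] (μ : Measure Y)
    [IsProbabilityMeasure μ] (k : ℕ) :
    MeasurePreserving (fun (y : ℕ → Y) (m : Fin k) => y m) (Measure.infinitePi fun _ => μ)
      (Measure.pi fun _ => μ) := by
  have hm : Measurable fun (y : ℕ → Y) (m : Fin k) => y m := by fun_prop
  refine ⟨hm, (Measure.pi_eq fun s hs => ?_).symm⟩
  rw [Measure.map_apply hm (MeasurableSet.univ_pi hs)]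
  have e : (fun (y : ℕ → Y) (m : Fin k) => y m) ⁻¹' (Set.univ.pi s) =
      Set.pi (Finset.range k) fun n => if h : n < k then s ⟨n, h⟩ else Set.univ := by
    ext y
    simp only [Set.mem_preimage, Set.mem_pi, Set.mem_univ, true_imp_iff, Finset.coe_range,
      Set.mem_Iio]
    refine ⟨fun h n hn => ?_, fun h m => ?_⟩
    · rw [dif_pos hn]
      exact h ⟨n, hn⟩
    · have := h m m.2
      rwa [dif_pos m.2] at this
  rw [e, Measure.infinitePi_pi]
  · rw [Finset.prod_range]
    exact Finset.prod_congr rfl fun m _ => by simp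
  · intro n hn
    rw [dif_pos (Finset.mem_range.1 hn)]
    exact hs _

lemma pi_toMeasure_singleton {n : ℕ} (P : PMF X) (x : Fin n → X) :
    (Measure.pi fun _ : Fin n => P.toMeasure) {x} = ENNReal.ofReal (lik (mass P) x) := by
  rw [Measure.pi_singleton, lik, ENNReal.ofReal_prod_of_nonneg fun k _ => (mass_mem P).1 _]
  refine Finset.prod_congr rfl fun k _ => ?_
  rw [PMF.toMeasure_apply_singleton _ _ (measurableSet_singleton _), ofReal_mass]

variable [DecidableEq X]

/-- The method of types: a uniform bound on likelihood ratios bounds a probability up to a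
polynomial factor. -/
lemma law_le {M N k : ℕ} (P : Fin M → PMF X) (i j : Fin M) {E : Set ((Fin N → X) × (Fin k → X))}
    {b : ℝ} (hE : ∀ x y, (x, y) ∈ E →
      lik (mass (P j)) x * lik (mass (P i)) y ≤ b * (maxLik x * maxLik y)) (hb : 0 ≤ b) :
    law P N i {ω | (ω.1 j, fun m : Fin k => ω.2 m) ∈ E} ≤ ENNReal.ofReal
      (((N : ℝ) + 1) ^ Fintype.card X * ((k : ℝ) + 1) ^ Fintype.card X * b) := by
  classical
  have hmp := (measurePreserving_eval (fun j => Measure.pi fun _ : Fin N => (P j).toMeasure) j).prod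
    (measurePreserving_prefix (P i).toMeasure k)
  have h1 := hmp.measure_preimage (s := E) (Set.toFinite E).measurableSet.nullMeasurableSet
  change law P N i _ = _ at h1
  change law P N i (Prod.map (Function.eval j) (fun (y : ℕ → X) (m : Fin k) => y m) ⁻¹' E) ≤ _
  rw [h1, ← Set.coe_toFinset E, ← sum_measure_singleton]
  have h2 : ∀ z : (Fin N → X) × (Fin k → X), ((Measure.pi fun _ : Fin N => (P j).toMeasure).prod
      (Measure.pi fun _ : Fin k => (P i).toMeasure)) {z} =
      ENNReal.ofReal (lik (mass (P j)) z.1 * lik (mass (P i)) z.2) := by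
    intro z
    rw [← Prod.mk.eta (p := z), ← Set.singleton_prod_singleton, Measure.prod_prod,
      pi_toMeasure_singleton, pi_toMeasure_singleton,
      ← ENNReal.ofReal_mul (lik_nonneg (mass_mem _).1 _)]
  rw [Finset.sum_congr rfl fun z _ => h2 z, ← ENNReal.ofReal_sum_of_nonneg fun z _ =>
    mul_nonneg (lik_nonneg (mass_mem _).1 _) (lik_nonneg (mass_mem _).1 _)]
  refine ENNReal.ofReal_le_ofReal ?_
  calc _ ≤ ∑ z ∈ E.toFinset, b * (maxLik z.1 * maxLik z.2) :=
        Finset.sum_le_sum fun z hz => hE z.1 z.2 (Set.mem_toFinset.1 hz)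
    _ ≤ ∑ z : (Fin N → X) × (Fin k → X), b * (maxLik z.1 * maxLik z.2) :=
        Finset.sum_le_sum_of_subset_of_nonneg (Finset.subset_univ _) fun z _ _ =>
          mul_nonneg hb (mul_pos (maxLik_pos _) (maxLik_pos _)).le
    _ = b * ((∑ x : Fin N → X, maxLik x) * ∑ y : Fin k → X, maxLik y) := by
        rw [← Finset.mul_sum, Fintype.sum_prod_type, Finset.sum_mul_sum]
    _ ≤ b * (((N : ℝ) + 1) ^ Fintype.card X * ((k : ℝ) + 1) ^ Fintype.card X) := by
        gcongr
        · exact Finset.sum_nonneg fun y _ => (maxLik_pos y).le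
        · exact sum_maxLik_le N
        · exact sum_maxLik_le k
    _ = _ := by ring

end Law

/-! ### Pathwise properties of the test -/

section Test

variable {X : Type*} [Fintype X] [DecidableEq X] {M N : ℕ} {γ : ℝ} {ω : Obs X M N} {i : Fin M}

lemma stopTime_le : stopTime γ ω ≤ N ^ 2 := Nat.sInf_le (Set.mem_insert _ _)

lemma stopTime_mem : stopTime γ ω = N ^ 2 ∨ M - 1 ≤ (Psi γ ω (stopTime γ ω)).ncard := by
  rcases Nat.sInf_mem (Set.insert_nonempty (N ^ 2)
    {n : ℕ | 1 ≤ n ∧ M - 1 ≤ (Psi γ ω n).ncard}) with h | h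
  · exact Or.inl h
  · exact Or.inr h.2

lemma one_le_stopTime (hN : 1 ≤ N) : 1 ≤ stopTime γ ω := by
  rcases Nat.sInf_mem (Set.insert_nonempty (N ^ 2)
    {n : ℕ | 1 ≤ n ∧ M - 1 ≤ (Psi γ ω n).ncard}) with h | h
  · rw [stopTime, h]
    exact Nat.one_le_pow _ _ hN
  · exact h.1

lemma score_lt_of_notMem_Psi {j : Fin M} {k : ℕ} (hk : 1 ≤ k) (h : j ∉ Psi γ ω k) :
    score ω j k < γ * N := by
  by_contra! hge
  exact h ⟨k, hk, le_rfl, hge⟩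

lemma exists_score_lt_of_lt_stopTime (i : Fin M) {k : ℕ} (hk : 1 ≤ k) (h : k < stopTime γ ω) :
    ∃ j, j ≠ i ∧ score ω j k < γ * N := by
  by_contra! hall
  have hsub : {i}ᶜ ⊆ Psi γ ω k := fun j hj => ⟨k, hk, le_rfl, hall j hj⟩
  have hc := Set.ncard_le_ncard hsub
  rw [Set.ncard_compl, Set.ncard_singleton, Nat.card_eq_fintype_card, Fintype.card_fin] at hc
  exact absurd h (not_lt.2 (Nat.sInf_le (Set.mem_insert_of_mem _ ⟨hk, hc⟩)))

/-- A wrong decision needs a large score of the true class or a small final score of another. -/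
lemma exists_of_decision_ne (hN : 1 ≤ N) (h : decision γ ω ≠ {i}) :
    (∃ k ∈ Finset.Icc 1 (N ^ 2), γ * N ≤ score ω i k) ∨
      ∃ j, j ≠ i ∧ score ω j (N ^ 2) < γ * N := by
  by_cases hi : i ∈ Psi γ ω (stopTime γ ω)
  · obtain ⟨k, hk1, hk2, hk⟩ := hi
    exact Or.inl ⟨k, Finset.mem_Icc.2 ⟨hk1, hk2.trans stopTime_le⟩, hk⟩
  · right
    obtain ⟨j, hji, hj⟩ : ∃ j, j ≠ i ∧ j ∉ Psi γ ω (stopTime γ ω) := by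
      by_contra! hall
      refine h (Set.ext fun j => ⟨fun hj => ?_, fun hj => ?_⟩)
      · by_contra hne
        exact hj (hall j hne)
      · rw [Set.mem_singleton_iff.1 hj]
        exact hi
    -- With both `i` and `j` missing, the count cannot have stopped the test, so `T = N ^ 2`.
    have hcard : (Psi γ ω (stopTime γ ω)).ncard ≤ M - 2 := by
      have hsub : Psi γ ω (stopTime γ ω) ⊆ {i, j}ᶜ := by
        intro l hl hl'
        rcases hl' with rfl | rfl
        · exact hi hl
        · exact hj hl
      have := Set.ncard_le_ncard hsub
      rwa [Set.ncard_compl, Set.ncard_pair hji.symm, Nat.card_eq_fintype_card,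
        Fintype.card_fin] at this
    -- Needed for `M - 2 < M - 1` in truncated subtraction.
    have hM : 2 ≤ M := by
      have := i.2
      have := j.2
      have : (i : ℕ) ≠ j := fun h => hji (Fin.ext h.symm)
      omega
    rcases stopTime_mem (γ := γ) (ω := ω) with hT | hT
    · rw [hT] at hj
      exact ⟨j, hji, score_lt_of_notMem_Psi (Nat.one_le_pow _ _ hN) hj⟩
    · omega

end Test

/-! ### Asymptotics of the error probability and of the expected time -/

section Asymptotics

lemma eventually_pow_le_exp {A δ : ℝ} (hA : 0 ≤ A) (hδ : 0 < δ) (D : ℕ) :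
    ∀ᶠ N : ℕ in atTop, (A * (N + 1)) ^ D ≤ Real.exp (δ * N) := by
  have hc : 0 < ((2 * A) ^ D + 1)⁻¹ := by positivity
  have h := ((isLittleO_pow_exp_pos_mul_atTop D hδ).comp_tendsto
    tendsto_natCast_atTop_atTop).bound hc
  filter_upwards [h, eventually_ge_atTop 1] with N hN h1
  have h1 : (1 : ℝ) ≤ N := by exact_mod_cast h1
  simp only [Function.comp, Real.norm_eq_abs, Real.abs_exp] at hN
  rw [abs_of_nonneg (by positivity), ← div_eq_inv_mul, le_div_iff₀ (by positivity)] at hN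
  calc _ ≤ (2 * A * N) ^ D := by
        refine pow_le_pow_left₀ (by positivity) ?_ D
        nlinarith
    _ = N ^ D * (2 * A) ^ D := by rw [mul_pow]; ring
    _ ≤ N ^ D * ((2 * A) ^ D + 1) := by gcongr; linarith
    _ ≤ _ := hN

variable {X : Type*} [Fintype X] [DecidableEq X] [MeasurableSpace X] {M : ℕ}

instance (P : Fin M → PMF X) (N : ℕ) (i : Fin M) : IsProbabilityMeasure (law P N i) := by
  unfold law
  infer_instance

lemma errProb_le_sum {P : Fin M → PMF X} {γ : ℝ} {i : Fin M} {N : ℕ} (hN : 1 ≤ N) :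
    errProb P γ i N ≤ ∑ k ∈ Finset.Icc 1 (N ^ 2), law P N i {ω | γ * N ≤ score ω i k} +
      ∑ j ∈ Finset.univ.erase i, law P N i {ω | score ω j (N ^ 2) < γ * N} := by
  refine (measure_mono (t := (⋃ k ∈ Finset.Icc 1 (N ^ 2), {ω | γ * N ≤ score ω i k}) ∪
    ⋃ j ∈ Finset.univ.erase i, {ω | score ω j (N ^ 2) < γ * N}) fun ω hω => ?_).trans
    ((measure_union_le _ _).trans
      (add_le_add (measure_biUnion_finset_le _ _) (measure_biUnion_finset_le _ _)))
  simp only [Set.mem_union, Set.mem_iUnion, Set.mem_ofPred_eq, Finset.mem_erase, Finset.mem_univ,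
    and_true, exists_prop]
  exact exists_of_decision_ne hN hω

/-- Either `T ≤ k` or a wrong class is below threshold at time `k`; on the latter event the cap `N ^
2` bounds `T`. -/
lemma expTime_le_sum {P : Fin M → PMF X} {γ : ℝ} {i : Fin M} {N k : ℕ} (hk : 1 ≤ k) :
    expTime P γ i N ≤ k +
      (N : ENNReal) ^ 2 * ∑ j ∈ Finset.univ.erase i, law P N i {ω | score ω j k < γ * N} := by
  set S : Set (Obs X M N) := ⋃ j ∈ Finset.univ.erase i, {ω | score ω j k < γ * N} with hS
  have hle : ∀ ω : Obs X M N, (stopTime γ ω : ENNReal) ≤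
      k + S.indicator (fun _ => (N : ENNReal) ^ 2) ω := by
    intro ω
    rcases le_or_gt (stopTime γ ω) k with h | h
    · exact le_add_right (by exact_mod_cast h)
    · have hω : ω ∈ S := by
        simp only [hS, Set.mem_iUnion, Set.mem_ofPred_eq, Finset.mem_erase, Finset.mem_univ,
          and_true, exists_prop]
        exact exists_score_lt_of_lt_stopTime i hk h
      rw [Set.indicator_of_mem hω]
      exact le_add_left (by exact_mod_cast stopTime_le)
  calc expTime P γ i N ≤ ∫⁻ ω, (k + S.indicator (fun _ => (N : ENNReal) ^ 2) ω) ∂(law P N i) :=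
        lintegral_mono hle
    _ = k + ∫⁻ ω, S.indicator (fun _ => (N : ENNReal) ^ 2) ω ∂(law P N i) := by
        rw [lintegral_add_left measurable_const, lintegral_const, measure_univ, mul_one]
    _ ≤ k + (N : ENNReal) ^ 2 * law P N i S := by
        gcongr
        exact lintegral_indicator_const_le _ _
    _ ≤ _ := by
        gcongr
        exact measure_biUnion_finset_le _ _

lemma one_le_expTime {P : Fin M → PMF X} {γ : ℝ} {i : Fin M} {N : ℕ} (hN : 1 ≤ N) :
    1 ≤ expTime P γ i N := by
  calc (1 : ENNReal) = ∫⁻ _, 1 ∂(law P N i) := by simp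
    _ ≤ _ := lintegral_mono fun ω =>
        Nat.one_le_cast.2 (one_le_stopTime hN)

variable [DiscreteMeasurableSpace X]

/-- The error probability decays at rate at least `γ`. -/
lemma eventually_errProb_le {P : Fin M → PMF X} {γ ε : ℝ} {i : Fin M} (hε : 0 < ε)
    (h : ∀ j, j ≠ i → ∃ η : ℝ, 0 < η ∧ η < 1 ∧
      bhat η (mass (P j)) (mass (P i)) ≤ Real.exp (-γ)) :
    ∀ᶠ N : ℕ in atTop, errProb P γ i N ≤ ENNReal.ofReal (Real.exp (-((γ - ε) * N))) := by
  set d := Fintype.card X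
  have hj : ∀ j : Fin M, ∀ᶠ N : ℕ in atTop, j ≠ i → law P N i {ω | score ω j (N ^ 2) < γ * N} ≤
      ENNReal.ofReal (((N : ℝ) + 1) ^ d * (((N ^ 2 : ℕ) : ℝ) + 1) ^ d *
        Real.exp (-((γ - ε / 2) * N))) := by
    intro j
    by_cases hji : j = i
    · exact Eventually.of_forall fun N h => absurd hji h
    obtain ⟨η, h0, h1, hb⟩ := h j hji
    obtain ⟨K, hK⟩ := exists_pow_bhat_le h0 h1 (mul_pos h0 (half_pos hε)) (mass_mem _) (mass_mem _)
      hb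
    filter_upwards [eventually_ge_atTop 1, eventually_ge_atTop K] with N hN hKN _
    refine law_le (E := {z | pairScore z.1 z.2 < γ * N}) P i j (fun x y hxy => ?_)
      (Real.exp_pos _).le
    exact lik_le_of_score_lt hN (Nat.pow_pos hN) h0 h1 (mass_mem _) (mass_mem _)
      (by rw [sq]; exact Nat.mul_le_mul_right N hKN) hK x y hxy
  -- The exponent `2 + (d + 2 * d)` accounts for the `N ^ 2 + M` events of the union bound, the
  -- training types, and the test types of length up to `N ^ 2`.
  filter_upwards [eventually_all.2 hj, eventually_ge_atTop 1,
    eventually_pow_le_exp (A := M + 1) (by positivity) (half_pos hε) (2 + (d + 2 * d))]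
    with N hj hN hpoly
  have hN1 : (1 : ℝ) ≤ N := by exact_mod_cast hN
  set B : ℝ := ((N : ℝ) + 1) ^ d * (((N ^ 2 : ℕ) : ℝ) + 1) ^ d * Real.exp (-((γ - ε / 2) * N))
    with hB
  have hB0 : 0 ≤ B := by positivity
  have hi : ∀ k ∈ Finset.Icc 1 (N ^ 2), law P N i {ω | γ * N ≤ score ω i k} ≤
      ENNReal.ofReal B := by
    intro k hk
    obtain ⟨hk1, hk2⟩ := Finset.mem_Icc.1 hk
    refine (law_le (E := {z | γ * N ≤ pairScore z.1 z.2}) P i i (fun x y hxy =>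
      lik_le_of_le_score hN hk1 (mass_mem _) x y hxy) (Real.exp_pos _).le).trans ?_
    refine ENNReal.ofReal_le_ofReal ?_
    have : (k : ℝ) ≤ ((N ^ 2 : ℕ) : ℝ) := by exact_mod_cast hk2
    rw [hB]
    gcongr
    linarith
  have hcard : (Finset.univ.erase i).card ≤ M := by
    simp
  calc errProb P γ i N ≤ ∑ k ∈ Finset.Icc 1 (N ^ 2), ENNReal.ofReal B +
        ∑ j ∈ Finset.univ.erase i, ENNReal.ofReal B :=
        (errProb_le_sum hN).trans (add_le_add (Finset.sum_le_sum hi)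
          (Finset.sum_le_sum fun j hjm => hj j (Finset.ne_of_mem_erase hjm)))
    _ ≤ (N ^ 2 : ℕ) * ENNReal.ofReal B + M * ENNReal.ofReal B := by
        simp only [Finset.sum_const, Nat.card_Icc, nsmul_eq_mul, add_tsub_cancel_right]
        gcongr
    _ = ENNReal.ofReal ((((N ^ 2 : ℕ) : ℝ) + M) * B) := by
        rw [ENNReal.ofReal_mul (p := ((N ^ 2 : ℕ) : ℝ) + M) (by positivity),
          ENNReal.ofReal_add (by positivity) (by positivity),
          ENNReal.ofReal_natCast, ENNReal.ofReal_natCast, add_mul]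
    _ ≤ _ := by
        refine ENNReal.ofReal_le_ofReal ?_
        set A : ℝ := (M + 1) * (N + 1) with hA
        have hM0 : (0 : ℝ) ≤ M := Nat.cast_nonneg M
        have h1 : (N : ℝ) + 1 ≤ A := by nlinarith
        have h2 : ((N ^ 2 : ℕ) : ℝ) + 1 ≤ A ^ 2 := by push_cast; nlinarith
        have h3 : ((N ^ 2 : ℕ) : ℝ) + M ≤ A ^ 2 := by
          have : (M : ℝ) ≤ (M + 1) * (N + 1) - (N + 1) := by nlinarith
          push_cast
          nlinarith
        calc _ = (((N ^ 2 : ℕ) : ℝ) + M) * (((N : ℝ) + 1) ^ d * (((N ^ 2 : ℕ) : ℝ) + 1) ^ d) *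
              Real.exp (-((γ - ε / 2) * N)) := by rw [hB]; ring
          _ ≤ A ^ 2 * (A ^ d * (A ^ 2) ^ d) * Real.exp (-((γ - ε / 2) * N)) := by gcongr
          _ = A ^ (2 + (d + 2 * d)) * Real.exp (-((γ - ε / 2) * N)) := by
              rw [← pow_mul, ← pow_add, ← pow_add]
          _ ≤ Real.exp (ε / 2 * N) * Real.exp (-((γ - ε / 2) * N)) := by gcongr
          _ = _ := by rw [← Real.exp_add]; ring_nf

/-- The expected time is at most `c N` up to a constant, once `phi (P j) (P i) c > γ` for all
wrong classes `j`. -/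
lemma eventually_expTime_le {P : Fin M → PMF X} {γ c : ℝ} {i : Fin M} (hc : 0 < c)
    (h : ∀ j, j ≠ i → γ < phi (mass (P j)) (mass (P i)) c) :
    ∀ᶠ N : ℕ in atTop, expTime P γ i N ≤ ENNReal.ofReal (c * N + 2) := by
  set d := Fintype.card X
  -- Three of these inverse powers suffice to absorb `N ^ 2` times the number of wrong classes.
  have hj : ∀ j : Fin M, ∀ᶠ N : ℕ in atTop, j ≠ i →
      law P N i {ω | score ω j ⌈c * N⌉₊ < γ * N} ≤
        ENNReal.ofReal (((M + c + 2) * (N + 1)) ^ (d + d + 3))⁻¹ := by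
    intro j
    by_cases hji : j = i
    · exact Eventually.of_forall fun N h => absurd hji h
    obtain ⟨r, hr0, hr1, hr⟩ := exists_bhat_mul_le hc (mass_mem _) (mass_mem _) (h j hji)
    have hδ : 0 < -Real.log r := neg_pos.2 (Real.log_neg hr0 hr1)
    filter_upwards [eventually_ge_atTop 1, eventually_pow_le_exp (A := M + c + 2) (by positivity) hδ
      ((d + d) + (d + d + 3))] with N hN hpoly _
    have hN1 : (1 : ℝ) ≤ N := by exact_mod_cast hN
    have hk : 0 < ⌈c * N⌉₊ := Nat.ceil_pos.2 (by positivity)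
    refine (law_le (E := {z | pairScore z.1 z.2 < γ * N}) P i j (b := r ^ N) (fun x y hxy =>
      lik_le_of_score_lt_of_bhat hN hk hc (mass_mem _) (mass_mem _) (Nat.le_ceil _) hr x y hxy)
      (by positivity)).trans (ENNReal.ofReal_le_ofReal ?_)
    have hM0 : (0 : ℝ) ≤ M := Nat.cast_nonneg M
    set A : ℝ := (M + c + 2) * (N + 1) with hA
    have hA0 : 0 < A := by positivity
    have h1 : (N : ℝ) + 1 ≤ A := by nlinarith
    have h2 : (⌈c * N⌉₊ : ℝ) + 1 ≤ A := by
      have := (Nat.ceil_lt_add_one (by positivity : 0 ≤ c * N)).le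
      nlinarith
    have hrN : r ^ N = (Real.exp (-Real.log r * N))⁻¹ := by
      rw [← Real.exp_neg, neg_mul, neg_neg, mul_comm, Real.exp_nat_mul, Real.exp_log hr0]
    rw [le_inv_comm₀ (by positivity) (by positivity), hrN, mul_inv, inv_inv, ← div_eq_inv_mul,
      le_div_iff₀ (by positivity)]
    calc A ^ (d + d + 3) * (((N : ℝ) + 1) ^ d * ((⌈c * N⌉₊ : ℝ) + 1) ^ d)
        ≤ A ^ (d + d + 3) * (A ^ d * A ^ d) := by gcongr
      _ = A ^ ((d + d) + (d + d + 3)) := by ring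
      _ ≤ _ := hpoly
  filter_upwards [eventually_all.2 hj, eventually_ge_atTop 1] with N hj hN
  have hN1 : (1 : ℝ) ≤ N := by exact_mod_cast hN
  have hk : 0 < ⌈c * N⌉₊ := Nat.ceil_pos.2 (by positivity)
  have hM0 : (0 : ℝ) ≤ M := Nat.cast_nonneg M
  set A : ℝ := (M + c + 2) * (N + 1) with hA
  have hA1 : 1 ≤ A := by nlinarith
  have hcard : (Finset.univ.erase i).card ≤ M := by
    simp
  calc expTime P γ i N ≤ ⌈c * N⌉₊ + (N : ENNReal) ^ 2 *
        ∑ j ∈ Finset.univ.erase i, ENNReal.ofReal (A ^ (d + d + 3))⁻¹ := by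
        refine (expTime_le_sum hk).trans ?_
        gcongr with j hjm
        exact hj j (Finset.ne_of_mem_erase hjm)
    _ ≤ ⌈c * N⌉₊ + (N : ENNReal) ^ 2 * (M * ENNReal.ofReal (A ^ (d + d + 3))⁻¹) := by
        rw [Finset.sum_const, nsmul_eq_mul]
        gcongr
    _ = ENNReal.ofReal (⌈c * N⌉₊ + (N : ℝ) ^ 2 * (M * (A ^ (d + d + 3))⁻¹)) := by
        rw [ENNReal.ofReal_add (by positivity) (by positivity), ENNReal.ofReal_mul (by positivity),
          ENNReal.ofReal_mul (by positivity), ENNReal.ofReal_natCast, ENNReal.ofReal_natCast,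
          ENNReal.ofReal_pow (by positivity), ENNReal.ofReal_natCast]
    _ ≤ _ := by
        refine ENNReal.ofReal_le_ofReal ?_
        have h1 := (Nat.ceil_lt_add_one (by positivity : 0 ≤ c * N)).le
        have h2 : (N : ℝ) ^ 2 * (M * (A ^ (d + d + 3))⁻¹) ≤ 1 := by
          rw [← mul_assoc, ← div_eq_mul_inv]
          refine div_le_one_of_le₀ ?_ (by positivity)
          calc (N : ℝ) ^ 2 * M ≤ A ^ 2 * A := by
                gcongr <;> nlinarith
            _ = A ^ 3 := by ring
            _ ≤ _ := pow_le_pow_right₀ hA1 (by omega)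
        linarith

end Asymptotics

/-! ### The root of the threshold equation and the error exponent -/

section Main

variable {X : Type*} [Fintype X]

/-- Dividing by `θ` removes the trivial root and leaves a strictly monotone function of `θ⁻¹` when
`P ≠ Q`. -/
lemma isThetaStar_iff {P Q : PMF X} {γ θ : ℝ} (hγ : 0 < γ) :
    IsThetaStar P Q γ θ ↔ 0 < θ ∧ phi (mass P) (mass Q) θ⁻¹ = γ := by
  have key : 0 < θ → gjs (mass P) (mass Q) θ = θ * phi (mass P) (mass Q) θ⁻¹ := fun h => by
    simpa using gjs_inv (mass P) (mass Q) (inv_pos.2 h)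
  constructor
  · rintro ⟨-, h0, h⟩
    have h0 := h0 hγ
    rw [key h0, mul_comm γ] at h
    exact ⟨h0, mul_left_cancel₀ h0.ne' h⟩
  · rintro ⟨h0, h⟩
    exact ⟨h0.le, fun _ => h0, by rw [key h0, h, mul_comm]⟩

lemma existsUnique_isThetaStar {P Q : PMF X} {γ η : ℝ} (hγ : 0 < γ) (h0 : 0 < η) (h1 : η < 1)
    (hb : bhat η (mass P) (mass Q) ≤ Real.exp (-γ)) : ∃! θ : ℝ, IsThetaStar P Q γ θ := by
  have hP := mass_mem P
  have hQ := mass_mem Q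
  obtain ⟨u, hu, hphi⟩ := exists_phi_eq h0 h1 hγ hP hQ hb
  refine ⟨u⁻¹, (isThetaStar_iff hγ).2 ⟨inv_pos.2 hu, by rwa [inv_inv]⟩, fun θ hθ => ?_⟩
  obtain ⟨hθ0, hθ⟩ := (isThetaStar_iff hγ).1 hθ
  have hv := inv_pos.2 hθ0
  have hne := ne_of_bhat_lt hγ hP hb
  rw [← inv_inv θ, inv_inj]
  rcases lt_trichotomy θ⁻¹ u with h | h | h
  · have := phi_strictMono hP hQ hne hv h
    linarith
  · exact h
  · have := phi_strictMono hP hQ hne hu h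
    linarith

variable [DecidableEq X] [MeasurableSpace X] {M : ℕ}

lemma errExponent_nonneg (P : Fin M → PMF X) (γ : ℝ) (i : Fin M) : 0 ≤ errExponent P γ i := by
  refine le_liminf_of_le (by isBoundedDefault) (Eventually.of_forall fun N => ?_)
  refine EReal.div_nonneg ?_ (EReal.coe_ennreal_nonneg _)
  rw [EReal.neg_nonneg, ENNReal.log_le_zero_iff]
  exact prob_le_one

variable [DiscreteMeasurableSpace X]

lemma le_errExponent {P : Fin M → PMF X} {γ t : ℝ} {i : Fin M} (hγ : 0 < γ) (ht : 0 < t)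
    (h : ∀ j, j ≠ i → ∃ η : ℝ, 0 < η ∧ η < 1 ∧
      bhat η (mass (P j)) (mass (P i)) ≤ Real.exp (-γ))
    (hθ : ∀ j, j ≠ i → ∃ θ, t ≤ θ ∧ IsThetaStar (P j) (P i) γ θ) :
    ((γ * t : ℝ) : EReal) ≤ errExponent P γ i := by
  refine le_of_forall_lt_imp_le_of_dense fun z hz => ?_
  have hpos : (0 : EReal) < ((γ * t : ℝ) : EReal) := by exact_mod_cast mul_pos hγ ht
  obtain ⟨r, hr1, hr2⟩ := EReal.lt_iff_exists_real_btwn.1 (max_lt hz hpos)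
  refine ((le_max_left _ _).trans hr1.le).trans ?_
  have hr0 : 0 < r := by exact_mod_cast (le_max_right _ _).trans_lt hr1
  have hr : r < γ * t := by exact_mod_cast hr2
  -- The slope `c` exceeds every `1 / θ_j`, so it bounds the expected time, yet still `c r < γ`.
  obtain ⟨c, hc1, hc2⟩ : ∃ c, t⁻¹ < c ∧ c < γ / r := by
    refine exists_between ?_
    rw [lt_div_iff₀ hr0, inv_mul_lt_iff₀ ht]
    linarith
  have hc0 : 0 < c := (inv_pos.2 ht).trans hc1
  rw [lt_div_iff₀ hr0] at hc2
  -- Half the slack: `γ - ε = c r + ε`, and `ε N ≥ 2 r` absorbs the constant `2` in the time bound.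
  set ε := (γ - c * r) / 2 with hε
  have hε0 : 0 < ε := by linarith
  have hphi : ∀ j, j ≠ i → γ < phi (mass (P j)) (mass (P i)) c := by
    intro j hj
    obtain ⟨θ, hθt, hθ⟩ := hθ j hj
    obtain ⟨η, -, -, hb⟩ := h j hj
    obtain ⟨hθ0, hθ⟩ := (isThetaStar_iff hγ).1 hθ
    have hlt : θ⁻¹ < c := (inv_anti₀ ht hθt).trans_lt hc1
    exact hθ.symm.trans_lt (phi_strictMono (mass_mem _) (mass_mem _)
      (ne_of_bhat_lt hγ (mass_mem _) hb) (inv_pos.2 hθ0) hlt)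
  refine le_liminf_of_le (by isBoundedDefault) ?_
  filter_upwards [eventually_errProb_le hε0 h, eventually_expTime_le hc0 hphi,
    eventually_ge_atTop 1, eventually_ge_atTop ⌈2 * r / ε⌉₊] with N hP hT hN hNr
  have hN' : 2 * r / ε ≤ N := Nat.ceil_le.1 hNr
  rw [div_le_iff₀ hε0] at hN'
  have hT1 := one_le_expTime (P := P) (γ := γ) (i := i) hN
  rw [EReal.le_div_iff_mul_le
    (EReal.coe_ennreal_pos.2 (one_pos.trans_le hT1))
    (by rw [Ne, EReal.coe_ennreal_eq_top_iff]; exact (hT.trans_lt ENNReal.ofReal_lt_top).ne)]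
  have hlog : (((γ - ε) * N : ℝ) : EReal) ≤ -ENNReal.log (errProb P γ i N) := by
    have := ENNReal.log_le_log hP
    rw [ENNReal.log_ofReal_of_pos (Real.exp_pos _), Real.log_exp, EReal.coe_neg] at this
    exact EReal.le_neg_of_le_neg this
  refine le_trans ?_ hlog
  have hTE : (expTime P γ i N : EReal) ≤ ((c * N + 2 : ℝ) : EReal) := by
    have := EReal.coe_ennreal_le_coe_ennreal_iff.2 hT
    rwa [EReal.coe_ennreal_ofReal, max_eq_left (by positivity)] at this
  calc (r : EReal) * (expTime P γ i N : EReal) ≤ (r : EReal) * ((c * N + 2 : ℝ) : EReal) :=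
        mul_le_mul_of_nonneg_left hTE (by exact_mod_cast hr0.le)
    _ = ((r * (c * N + 2) : ℝ) : EReal) := by rw [EReal.coe_mul]
    _ ≤ _ := by
        rw [EReal.coe_le_coe_iff]
        have : γ - ε = c * r + ε := by rw [hε]; ring
        rw [this]
        nlinarith

lemma tendsto_errProb {P : Fin M → PMF X} {γ : ℝ} {i : Fin M} (hγ : 0 < γ)
    (h : ∀ j, j ≠ i → ∃ η : ℝ, 0 < η ∧ η < 1 ∧
      bhat η (mass (P j)) (mass (P i)) ≤ Real.exp (-γ)) :
    Tendsto (errProb P γ i) atTop (𝓝 0) := by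
  have hlim : Tendsto (fun N : ℕ => ENNReal.ofReal (Real.exp (-((γ - γ / 2) * N)))) atTop
      (𝓝 0) := by
    rw [← ENNReal.ofReal_zero]
    refine ENNReal.tendsto_ofReal (Real.tendsto_exp_neg_atTop_nhds_zero.comp ?_)
    exact tendsto_natCast_atTop_atTop.const_mul_atTop (by linarith)
  exact tendsto_of_tendsto_of_tendsto_of_le_of_le' tendsto_const_nhds hlim
    (Eventually.of_forall fun _ => bot_le) (eventually_errProb_le (half_pos hγ) h)

end Main

end

end SeqClass

open SeqClass
theorem corollary2 {X : Type*} [Fintype X] [DecidableEq X] [MeasurableSpace X]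
    [DiscreteMeasurableSpace X] {M : ℕ} (hM : 2 < M) (P : Fin M → PMF X) (γ : ℝ) (hγ0 : 0 ≤ γ)
    (hγ : ∀ i j, i ≠ j → (γ : EReal) ≤ chernoff (P i) (P j))
    (hsupp : ∀ i j, i ≠ j → (γ : EReal) = chernoff (P i) (P j) → (P i).support = (P j).support) :
    (0 < γ → ∀ i j, i ≠ j → ∃! θ : ℝ, IsThetaStar (P j) (P i) γ θ) ∧
    (0 < γ → ∀ i, Tendsto (errProb P γ i) atTop (𝓝 0)) ∧
    ∀ θ : Fin M → Fin M → ℝ, (∀ i j, i ≠ j → IsThetaStar (P j) (P i) γ (θ i j)) →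
      ∀ i, ((⨅ j : {j : Fin M // j ≠ i}, gjs (mass (P j)) (mass (P i)) (θ i j) : ℝ) : EReal) ≤
        errExponent P γ i := by
  have hb : 0 < γ → ∀ i j, j ≠ i → ∃ η : ℝ, 0 < η ∧ η < 1 ∧
      bhat η (mass (P j)) (mass (P i)) ≤ Real.exp (-γ) := fun h i j hji =>
    exists_bhat_le h (hγ j i hji) (hsupp j i hji)
  refine ⟨fun h i j hij => ?_, fun h i => tendsto_errProb h (hb h i), fun θ hθ i => ?_⟩
  · obtain ⟨η, h0, h1, hη⟩ := hb h i j hij.symm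
    exact existsUnique_isThetaStar h h0 h1 hη
  · have hne : Nonempty {j : Fin M // j ≠ i} := by
      have : Nontrivial (Fin M) := Fin.nontrivial_iff_two_le.2 hM.le
      exact nonempty_subtype.2 (exists_ne i)
    -- At a root the divergence is `γ θ`, so for `γ > 0` the minimizing class has the smallest `θ`
    -- and crosses the threshold last.
    have hg : ∀ j : {j : Fin M // j ≠ i},
        gjs (mass (P j)) (mass (P i)) (θ i j) = γ * θ i j := fun j => (hθ i j j.2.symm).2.2
    obtain ⟨j₀, hj₀⟩ := exists_eq_ciInf_of_finite
      (f := fun j : {j : Fin M // j ≠ i} => gjs (mass (P j)) (mass (P i)) (θ i j))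
    rw [← hj₀, hg]
    rcases hγ0.eq_or_lt with h | h
    · rw [← h, zero_mul]
      exact errExponent_nonneg P 0 i
    · refine le_errExponent h ((hθ i j₀ j₀.2.symm).2.1 h) (hb h i) fun j hj =>
        ⟨θ i j, ?_, hθ i j hj.symm⟩
      have := ciInf_le (Set.finite_range
        fun j : {j : Fin M // j ≠ i} => gjs (mass (P j)) (mass (P i)) (θ i j)).bddBelow ⟨j, hj⟩
      rw [← hj₀, hg, hg] at this
      exact le_of_mul_le_mul_left this h
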